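/- **Model.** $N$ asynchronous deterministic processes $p_1,\dots,p_N$ communicate through shared variables (any number of them, with values of any kind) using only atomic reads and writes. In the DSM (distributed shared memory) model every shared variable resides in the memory module of exactly one of the $N$ processors, and $p_i$ runs on processor $i$; an access to a variable by $p_i$ is a *remote memory reference* (RMR) if the variable resides in the module of a processor other than $i$. A history is a sequence of steps taken, under arbitrary scheduling, from the initial configuration; a process participates in it if it takes at least one step. A history is fair if each participating process takes infinitely many steps or terminates, and a process crashes if it terminates in the middle of a procedure call. **Signaling problem (one signaler, many waiters, IDs not fixed in advance, polling semantics).** An algorithm $\mathcal A$ gives every process two procedures, $\mathrm{Signal}()$ and $\mathrm{Poll}()$, the latter returning a Boolean. Let $\mathcal H_{\mathcal A}$ be the set of finite histories of $\mathcal A$ in which processes call these procedures in any order and any number of times, except that at most one call to $\mathrm{Signal}$ is made in total (by an arbitrary process) and no process calls $\mathrm{Poll}$ again after one of its calls to $\mathrm{Poll}$ has returned true; calls may be incomplete at the end of the history, and a process may stop (terminate) after any of its completed calls. The algorithm solves the problem if in every $H\in\mathcal H_{\mathcal A}$: whenever a call to $\mathrm{Poll}$ returns true, some call to $\mathrm{Signal}$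 has already begun; and whenever a call to $\mathrm{Poll}$ returns false, no call to $\mathrm{Signal}$ completed before this call to $\mathrm{Poll}$ began. It is *terminating* if in every fair history in which no process crashes and all of whose finite prefixes are in $\mathcal H_{\mathcal A}$, each procedure call takes only finitely many steps. **Theorem.** For every integer $c\ge 1$ there is an $N_0$ such that for every $N\ge N_0$ and every deterministic terminating algorithm $\mathcal A$ for $N$ processes that solves this signaling problem using only atomic reads and writes, there exist an integer $k\ge 1$ and a history $H\in\mathcal H_{\mathcal A}$ in which exactly $k$ processes participate and together incur more than $c\,k$ RMRs in the DSM model. (Thus $O(1)$ amortized RMR complexity is impossible in the DSM model.) -/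

import Mathlib

universe u v w

namespace Signaling

/-- The two procedures of a solution to the signaling problem with polling semantics. -/
inductive Op where
  | poll
  | signal

/-- What the code of a procedure does next in a given local state: an atomic read of a shared
variable (the next local state depends on the value read), an atomic write, or the return from the
call with a Boolean response (the response of a `signal` call carries no meaning). -/
inductive Action (Var Val Loc : Type*) where
  | read (v : Var) (next : Val → Loc)
  | write (v : Var) (x : Val) (next : Loc)
  | ret (b : Bool) (next : Loc)

/-- A deterministic `N`-process shared-memory algorithm, using only atomic reads and writes, that
provides each process with the procedures `poll` and `signal`. The code is an arbitrary state
machine (the local state comprises the program counter and all private variables, which persist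
between calls), so that busy-waiting is possible; the number of shared variables and the values
they store are not restricted. In the DSM model each shared variable resides in the memory module
of one processor, and process `p` runs on processor `p`; `owner v` is the one whose module
holds `v`. -/
structure Algorithm (N : ℕ) (Var Val Loc : Type*) where
  /-- the processor in whose memory module a variable resides -/
  owner : Var → Fin N
  /-- initial contents of the shared memory -/
  initVal : Var → Val
  /-- initial local state of each process -/
  initLoc : Fin N → Loc
  /-- local state at the beginning of a call, given the local state just before it -/
  enter : Fin N → Op → Loc → Loc
  /-- the next action during a call -/
  act : Fin N → Loc → Action Var Val Loc

/-- The events that make up histories: beginning of a call, memory accesses (with the value read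
or written), and the completion of a call (with its response). -/
inductive Event (N : ℕ) (Var Val : Type*) where
  | invoke (p : Fin N) (o : Op)
  | read (p : Fin N) (v : Var) (x : Val)
  | write (p : Fin N) (v : Var) (x : Val)
  | ret (p : Fin N) (o : Op) (b : Bool)

/-- The process that performs an event. -/
def Event.proc {N : ℕ} {Var Val : Type*} : Event N Var Val → Fin N
  | .invoke p _ => p
  | .read p _ _ => p
  | .write p _ _ => p
  | .ret p _ _ => p

/-- The beginnings of calls to `signal`. -/
def Event.isSignalInvoke {N : ℕ} {Var Val : Type*} : Event N Var Val → Bool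
  | .invoke _ .signal => true
  | _ => false

/-- A global configuration: shared memory, local states, and for each process the procedure it is
currently executing (`none` between calls). -/
structure Config (N : ℕ) (Var Val Loc : Type*) where
  mem : Var → Val
  loc : Fin N → Loc
  pending : Fin N → Option Op

namespace Algorithm

variable {N : ℕ} {Var Val Loc : Type*}

/-- The initial configuration. -/
def initConfig (A : Algorithm N Var Val Loc) : Config N Var Val Loc where
  mem := A.initVal
  loc := A.initLoc
  pending := fun _ => none

open Classical in
/-- `A.Step C e C'`: in configuration `C` the event `e` can occur, and it leads to `C'`. A process
that is between calls may begin any call; a process that is executing a call performs the action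
prescribed by its code. -/
inductive Step (A : Algorithm N Var Val Loc) :
    Config N Var Val Loc → Event N Var Val → Config N Var Val Loc → Prop
  | invoke (C : Config N Var Val Loc) (p : Fin N) (o : Op) (hp : C.pending p = none) :
      Step A C (.invoke p o)
        ⟨C.mem, Function.update C.loc p (A.enter p o (C.loc p)),
          Function.update C.pending p (some o)⟩
  | read (C : Config N Var Val Loc) (p : Fin N) (o : Op) (v : Var) (next : Val → Loc)
      (hp : C.pending p = some o) (ha : A.act p (C.loc p) = .read v next) :
      Step A C (.read p v (C.mem v))
        ⟨C.mem, Function.update C.loc p (next (C.mem v)), C.pending⟩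
  | write (C : Config N Var Val Loc) (p : Fin N) (o : Op) (v : Var) (x : Val) (next : Loc)
      (hp : C.pending p = some o) (ha : A.act p (C.loc p) = .write v x next) :
      Step A C (.write p v x)
        ⟨Function.update C.mem v x, Function.update C.loc p next, C.pending⟩
  | ret (C : Config N Var Val Loc) (p : Fin N) (o : Op) (b : Bool) (next : Loc)
      (hp : C.pending p = some o) (ha : A.act p (C.loc p) = .ret b next) :
      Step A C (.ret p o b)
        ⟨C.mem, Function.update C.loc p next, Function.update C.pending p none⟩

/-- `A.Run H C`: the finite sequence of events `H` is an execution of `A` from the initial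
configuration, and it ends in `C`. The scheduling is arbitrary. -/
inductive Run (A : Algorithm N Var Val Loc) :
    List (Event N Var Val) → Config N Var Val Loc → Prop
  | nil : Run A [] A.initConfig
  | snoc (H : List (Event N Var Val)) (C C' : Config N Var Val Loc) (e : Event N Var Val)
      (hH : Run A H C) (he : A.Step C e C') : Run A (H ++ [e]) C'

end Algorithm

variable {N : ℕ} {Var Val Loc : Type*}

/-- The calling discipline of the one-signaler problem with polling semantics: `signal` is called
at most once altogether (by an arbitrary process), and no process calls `poll` again after one of
its calls to `poll` has returned `true`. -/
def Admissible (H : List (Event N Var Val)) : Prop :=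
  H.countP Event.isSignalInvoke ≤ 1 ∧
  ∀ (p : Fin N) (i j : ℕ), i < j → H[i]? = some (.ret p .poll true) →
    H[j]? ≠ some (.invoke p .poll)

/-- The finite histories of `A` in which processes call `poll` and `signal` according to the
calling discipline; some calls may still be incomplete at the end, and a process that takes no
further steps after its last completed call has terminated. -/
def Algorithm.histories (A : Algorithm N Var Val Loc) : Set (List (Event N Var Val)) :=
  {H | (∃ C, A.Run H C) ∧ Admissible H}

/-- In `H`, process `p` makes a call to `o` that begins at position `i` and completes at position
`j` with response `b`. -/
def IsCall (H : List (Event N Var Val)) (p : Fin N) (o : Op) (i j : ℕ) (b : Bool) : Prop :=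
  i < j ∧ H[i]? = some (.invoke p o) ∧ H[j]? = some (.ret p o b) ∧
  ∀ m, i < m → m < j → ∀ (o' : Op) (b' : Bool), H[m]? ≠ some (.ret p o' b')

/-- The safety properties of the signaling problem: if some call to `poll` returns `true` then some
call to `signal` has already begun, and if some call to `poll` returns `false` then no call to
`signal` completed before this call to `poll` began. -/
def Safe (H : List (Event N Var Val)) : Prop :=
  (∀ (p : Fin N) (i j : ℕ), IsCall H p .poll i j true →
    ∃ m < j, ∃ q, H[m]? = some (.invoke q .signal)) ∧
  (∀ (p : Fin N) (i j : ℕ), IsCall H p .poll i j false →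
    ∀ m < i, ∀ (q : Fin N) (b : Bool), H[m]? ≠ some (.ret q .signal b))

/-- `A` solves the signaling problem (one signaler, many waiters, IDs not fixed in advance, polling
semantics). -/
def Algorithm.SolvesSignaling (A : Algorithm N Var Val Loc) : Prop :=
  ∀ H ∈ A.histories, Safe H

/-- In the infinite history `σ`, every call made by `p` is eventually completed. -/
def CallsComplete (σ : ℕ → Event N Var Val) (p : Fin N) : Prop :=
  ∀ (i : ℕ) (o : Op), σ i = .invoke p o → ∃ j > i, ∃ b, σ j = .ret p o b

/-- The infinite history `σ` is fair and no process crashes in it: each process either takes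
infinitely many steps or terminates, but not in the middle of a call. -/
def FairCrashFree (σ : ℕ → Event N Var Val) : Prop :=
  ∀ p : Fin N, (∀ n, ∃ m ≥ n, (σ m).proc = p) ∨
    ((∃ n, ∀ m ≥ n, (σ m).proc ≠ p) ∧ CallsComplete σ p)

/-- `A` is terminating: in every fair history without crashes each call takes only finitely many
steps, that is, it is eventually completed (this concerns infinite histories only). -/
def Algorithm.Terminating (A : Algorithm N Var Val Loc) : Prop :=
  ∀ σ : ℕ → Event N Var Val, (∀ n, (List.range n).map σ ∈ A.histories) → FairCrashFree σ →
    ∀ p, CallsComplete σ p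

/-- The set of processes that participate in `H`. -/
def participants (H : List (Event N Var Val)) : Finset (Fin N) :=
  (H.map Event.proc).toFinset

/-- An event is a remote memory reference in the DSM model if it accesses a variable that resides
in the memory module of another processor. -/
def Algorithm.isRMR (A : Algorithm N Var Val Loc) : Event N Var Val → Bool
  | .read p v _ => decide (A.owner v ≠ p)
  | .write p v _ => decide (A.owner v ≠ p)
  | _ => false

/-- The total number of remote memory references in `H` in the DSM model. -/
def Algorithm.rmrCount (A : Algorithm N Var Val Loc) (H : List (Event N Var Val)) : ℕ :=
  H.countP A.isRMR

end Signaling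

/-!
The proof is an adversary argument based on erasing processes. Suppose that every history has at
most `c` remote memory references (RMRs) per participant. All processes call `poll`, and the
scheduler keeps a large set `act` of them *invisible*: any subset of these can be erased from the
history without anybody else noticing. `Algorithm.Family` expresses this by requiring that for all
`S ⊆ act` the history restricted to `S` and a small set `fin` of visible processes is again a
history, with the same local states, where the value of each variable depends on at most one
membership in `S`. Hence a process about to access a variable that depends on the invisible process
`q` can be dealt with by erasing `q` first.

The construction proceeds in rounds. Steps on a process's own memory module never make it visible,
so each invisible process can run until its next step is an RMR, unless it is *stable* and never
makes an RMR again by polling alone. If there are many unstable processes, then either many of the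
pending RMRs do not interfere (`Stage.access`; an independent set in a graph with out-degrees at
most one), or many of them are writes to the same variable (`Stage.overwrite`). In the latter case
only the last written value survives, and its writer becomes visible and completes its call. A
visible process performs the same steps when all invisible ones are erased, so the assumed bound
limits its RMRs to `c * fin.card`, and each RMR costs at most one erasure (`Family.rollForward`).
Termination is used only for processes that run alone while all others are between calls
(`Terminating.solo_completes`). After `c + 1` rounds each invisible process would have made `c + 1`
RMRs, while there are at most `c + 1` visible ones, contrary to the assumed bound.

So at some point many invisible processes are stable (`Stage.false_of_stable`). Let one of them call
`signal`. As before, the call completes after boundedly many erasures, and some stable process `p`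
remains that has noticed nothing. The next `poll` of `p` runs without RMRs, hence exactly as it
would without the signal; it can return neither `true` nor `false`.
-/

namespace Signaling

variable {N : ℕ} {Var : Type u} {Val : Type v} {Loc : Type w}

/-! ### Executions as functions on configurations -/

/-- The shared variable that an event accesses, if any. -/
def Event.target : Event N Var Val → Option Var
  | .read _ v _ => some v
  | .write _ v _ => some v
  | _ => none

namespace Algorithm

open Classical in
/-- The configuration that results from an event. Local states that do not match the event are left
alone, so that this is a total function; only events that are `Enabled` matter. -/
noncomputable def apply (A : Algorithm N Var Val Loc) (C : Config N Var Val Loc) :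
    Event N Var Val → Config N Var Val Loc
  | .invoke p o => ⟨C.mem, Function.update C.loc p (A.enter p o (C.loc p)),
      Function.update C.pending p (some o)⟩
  | .read p _ x => ⟨C.mem, Function.update C.loc p
      (match A.act p (C.loc p) with
        | .read _ next => next x
        | _ => C.loc p), C.pending⟩
  | .write p v x => ⟨Function.update C.mem v x, Function.update C.loc p
      (match A.act p (C.loc p) with
        | .write _ _ next => next
        | _ => C.loc p), C.pending⟩
  | .ret p _ _ => ⟨C.mem, Function.update C.loc p
      (match A.act p (C.loc p) with
        | .ret _ next => next
        | _ => C.loc p), Function.update C.pending p none⟩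

/-- The event can occur in the configuration `C`. -/
def Enabled (A : Algorithm N Var Val Loc) (C : Config N Var Val Loc) : Event N Var Val → Prop
  | .invoke p _ => C.pending p = none
  | .read p v x => C.pending p ≠ none ∧ (∃ next, A.act p (C.loc p) = .read v next) ∧ x = C.mem v
  | .write p v x => C.pending p ≠ none ∧ ∃ next, A.act p (C.loc p) = .write v x next
  | .ret p o b => C.pending p = some o ∧ ∃ next, A.act p (C.loc p) = .ret b next

/-- The events of the list can occur one after the other, beginning in `C`. -/
def Valid (A : Algorithm N Var Val Loc) : Config N Var Val Loc → List (Event N Var Val) → Prop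
  | _, [] => True
  | C, e :: L => A.Enabled C e ∧ Valid A (A.apply C e) L

/-- The configuration reached from `C` by a list of events. -/
noncomputable def exec (A : Algorithm N Var Val Loc) (C : Config N Var Val Loc)
    (L : List (Event N Var Val)) : Config N Var Val Loc :=
  L.foldl A.apply C

/-- The configuration reached by a list of events from the initial configuration. -/
noncomputable def after (A : Algorithm N Var Val Loc) (H : List (Event N Var Val)) :
    Config N Var Val Loc :=
  A.exec A.initConfig H

variable {A : Algorithm N Var Val Loc} {C C' : Config N Var Val Loc} {e : Event N Var Val}
  {H L : List (Event N Var Val)} {p q : Fin N} {o : Op}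

theorem step_iff : A.Step C e C' ↔ A.Enabled C e ∧ C' = A.apply C e := by
  constructor
  · rintro (⟨p, o, hp⟩ | ⟨p, o, v, next, hp, ha⟩ | ⟨p, o, v, x, next, hp, ha⟩ |
      ⟨p, o, b, next, hp, ha⟩)
    · exact ⟨hp, rfl⟩
    · exact ⟨⟨by simp [hp], ⟨next, ha⟩, rfl⟩, by simp [apply, ha]⟩
    · exact ⟨⟨by simp [hp], ⟨next, ha⟩⟩, by simp [apply, ha]⟩
    · exact ⟨⟨hp, ⟨next, ha⟩⟩, by simp [apply, ha]⟩
  · rintro ⟨h, rfl⟩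
    cases e with
    | invoke p o => exact .invoke C p o h
    | read p v x =>
      obtain ⟨h1, ⟨next, h2⟩, rfl⟩ := h
      obtain ⟨o, ho⟩ := Option.ne_none_iff_exists'.mp h1
      simpa [apply, h2] using Step.read C p o v next ho h2
    | write p v x =>
      obtain ⟨h1, ⟨next, h2⟩⟩ := h
      obtain ⟨o, ho⟩ := Option.ne_none_iff_exists'.mp h1
      simpa [apply, h2] using Step.write C p o v x next ho h2
    | ret p o b =>
      obtain ⟨h1, ⟨next, h2⟩⟩ := h
      simpa [apply, h2] using Step.ret C p o b next h1 h2

@[simp] theorem exec_nil : A.exec C [] = C := rfl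

@[simp] theorem exec_cons : A.exec C (e :: L) = A.exec (A.apply C e) L := rfl

theorem exec_append : A.exec C (H ++ L) = A.exec (A.exec C H) L := List.foldl_append ..

theorem after_append : A.after (H ++ L) = A.exec (A.after H) L := exec_append

theorem valid_append : A.Valid C (H ++ L) ↔ A.Valid C H ∧ A.Valid (A.exec C H) L := by
  induction H generalizing C with
  | nil => simp [Valid]
  | cons e H ih => simp [Valid, ih, and_assoc]

theorem run_iff : A.Run H C ↔ A.Valid A.initConfig H ∧ C = A.after H := by
  constructor
  · intro h
    induction h with
    | nil => exact ⟨trivial, rfl⟩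
    | snoc H C C' e _ he ih =>
      obtain ⟨ih, rfl⟩ := ih
      obtain ⟨he', rfl⟩ := step_iff.mp he
      exact ⟨valid_append.mpr ⟨ih, he', trivial⟩, by simp [after_append]⟩
  · rintro ⟨h, rfl⟩
    induction H using List.reverseRecOn with
    | nil => exact .nil
    | append_singleton H e ih =>
      rw [valid_append] at h
      exact .snoc H _ _ e (ih h.1) (step_iff.mpr ⟨h.2.1, by simp [after_append]⟩)

theorem mem_histories : H ∈ A.histories ↔ A.Valid A.initConfig H ∧ Admissible H := by
  simp [histories, run_iff]

theorem apply_loc_of_ne (h : e.proc ≠ q) : (A.apply C e).loc q = C.loc q := by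
  cases e <;> exact Function.update_of_ne (f := C.loc) (Ne.symm h) _

theorem apply_pending_of_ne (h : e.proc ≠ q) : (A.apply C e).pending q = C.pending q := by
  cases e <;> first | rfl | exact Function.update_of_ne (f := C.pending) (Ne.symm h) _

theorem apply_mem_of_ne {v : Var} (h : e.target ≠ some v) : (A.apply C e).mem v = C.mem v := by
  cases e with
  | write p u x =>
    have hvu : v ≠ u := by
      rintro rfl
      exact h rfl
    simp [apply, hvu]
  | _ => rfl

theorem apply_pending_of_target (h : e.target ≠ none) :
    (A.apply C e).pending = C.pending := by
  cases e <;> first | rfl | exact absurd rfl h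

/-! ### The view of a process -/

/-- The configurations `C` and `C'` look the same to process `p` as long as it makes no remote
memory reference. -/
structure SameView (A : Algorithm N Var Val Loc) (p : Fin N) (C C' : Config N Var Val Loc) :
    Prop where
  loc : C.loc p = C'.loc p
  pending : C.pending p = C'.pending p
  mem : ∀ v, A.owner v = p → C.mem v = C'.mem v

theorem SameView.refl : A.SameView p C C := ⟨rfl, rfl, fun _ _ => rfl⟩

theorem SameView.symm (h : A.SameView p C C') : A.SameView p C' C :=
  ⟨h.loc.symm, h.pending.symm, fun v hv => (h.mem v hv).symm⟩

theorem SameView.trans {C'' : Config N Var Val Loc} (h : A.SameView p C C')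
    (h' : A.SameView p C' C'') : A.SameView p C C'' :=
  ⟨h.loc.trans h'.loc, h.pending.trans h'.pending,
    fun v hv => (h.mem v hv).trans (h'.mem v hv)⟩

/-- The event is a step of `p` that makes no remote memory reference and begins no call to
`signal`. -/
structure IsLocal (A : Algorithm N Var Val Loc) (p : Fin N) (e : Event N Var Val) : Prop where
  proc : e.proc = p
  rmr : A.isRMR e = false
  signal : e.isSignalInvoke = false

theorem owner_of_not_rmr {v : Var} (h : A.isRMR e = false) (hv : e.target = some v) :
    A.owner v = e.proc := by
  cases e <;> simp_all [isRMR, Event.target, Event.proc]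

theorem SameView.enabled (h : A.SameView p C C') (he : A.IsLocal p e) (hen : A.Enabled C e) :
    A.Enabled C' e := by
  obtain ⟨rfl, hr, -⟩ := he
  cases e with
  | invoke p o => exact h.pending.symm.trans hen
  | read p v x =>
    obtain ⟨h1, h2, h3⟩ := hen
    refine ⟨h.pending ▸ h1, ?_, h3.trans (h.mem v (owner_of_not_rmr hr rfl))⟩
    rw [← show C.loc p = C'.loc p from h.loc]; exact h2
  | write p v x =>
    refine ⟨h.pending ▸ hen.1, ?_⟩
    rw [← show C.loc p = C'.loc p from h.loc]; exact hen.2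
  | ret p o b =>
    refine ⟨h.pending.symm.trans hen.1, ?_⟩
    rw [← show C.loc p = C'.loc p from h.loc]; exact hen.2

theorem SameView.apply (h : A.SameView e.proc C C') :
    A.SameView e.proc (A.apply C e) (A.apply C' e) := by
  obtain ⟨h1, h2, h3⟩ := h
  cases e <;> simp only [Event.proc] at * <;>
    refine ⟨by simp [Algorithm.apply, h1], by simp [Algorithm.apply, h2], fun u hu => ?_⟩
  case write p v x =>
    by_cases huv : u = v
    · subst huv; simp [Algorithm.apply]
    · simp [Algorithm.apply, huv, h3 u hu]
  all_goals exact h3 u hu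

theorem SameView.exec (h : A.SameView p C C') (hL : ∀ e ∈ L, A.IsLocal p e)
    (hv : A.Valid C L) : A.Valid C' L ∧ A.SameView p (A.exec C L) (A.exec C' L) := by
  induction L generalizing C C' with
  | nil => exact ⟨trivial, h⟩
  | cons e L ih =>
    have he := hL e (by simp)
    have h' : A.SameView p (A.apply C e) (A.apply C' e) := by
      obtain ⟨rfl, -, -⟩ := he
      exact h.apply
    obtain ⟨h1, h2⟩ := ih h' (fun e he => hL e (by simp [he])) hv.2
    exact ⟨⟨h.enabled he hv.1, h1⟩, h2⟩

/-- A process does not notice a step of another process that does not access its memory module. -/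
theorem sameView_apply_of_ne (h : e.proc ≠ q) (h' : ∀ v, e.target = some v → A.owner v ≠ q) :
    A.SameView q (A.apply C e) C :=
  ⟨apply_loc_of_ne h, apply_pending_of_ne h, fun v hv => apply_mem_of_ne fun ht => h' v ht hv⟩

theorem IsLocal.sameView_apply (he : A.IsLocal p e) (h : p ≠ q) :
    A.SameView q (A.apply C e) C := by
  obtain ⟨rfl, hr, -⟩ := he
  exact sameView_apply_of_ne h fun v hv => by rw [owner_of_not_rmr hr hv]; exact h

theorem sameView_exec_of_ne (hL : ∀ e ∈ L, A.IsLocal p e) (h : p ≠ q) :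
    A.SameView q (A.exec C L) C := by
  induction L generalizing C with
  | nil => exact .refl
  | cons e L ih =>
    exact (ih fun e he => hL e (by simp [he])).trans ((hL e (by simp)).sameView_apply h)

theorem exec_pending_of_ne (h : ∀ e ∈ L, e.proc ≠ q) :
    (A.exec C L).pending q = C.pending q := by
  induction L generalizing C with
  | nil => rfl
  | cons e L ih =>
    rw [exec_cons, ih fun e he => h e (by simp [he]), apply_pending_of_ne (h e (by simp))]

/-! ### Calls in progress -/

/-- Every call is completed or still in progress. -/
theorem ret_or_pending (hH : A.Valid A.initConfig H) {i : ℕ}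
    (hi : H[i]? = some (.invoke q o)) :
    (∃ j > i, ∃ b, H[j]? = some (.ret q o b)) ∨ (A.after H).pending q = some o := by
  induction H using List.reverseRecOn with
  | nil => simp at hi
  | append_singleton H e ih =>
    rw [valid_append] at hH
    obtain ⟨hH, he, -⟩ := hH
    change A.Enabled (A.after H) e at he
    rw [after_append]
    simp only [exec_cons, exec_nil]
    rcases lt_or_ge i H.length with hlt | hge
    · rw [List.getElem?_append_left hlt] at hi
      rcases ih hH hi with ⟨j, hj, b, hb⟩ | hpend
      · refine .inl ⟨j, hj, b, ?_⟩
        rwa [List.getElem?_append_left (List.getElem?_eq_some_iff.mp hb).1]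
      · by_cases hq : e.proc = q
        · cases e with
          | invoke p o' => subst hq; exact absurd (hpend.symm.trans he) (by simp)
          | read p v x => exact .inr hpend
          | write p v x => exact .inr hpend
          | ret p o' b =>
            subst hq
            obtain rfl : o = o' := Option.some.inj (hpend.symm.trans he.1)
            exact .inl ⟨H.length, hlt, b, by simp [Event.proc]⟩
        · exact .inr ((apply_pending_of_ne hq).trans hpend)
    · rw [List.getElem?_append_right hge] at hi
      have : i - H.length = 0 := by
        have := (List.getElem?_eq_some_iff.mp hi).1
        simp at this; omega
      rw [this] at hi
      simp only [List.getElem?_cons_zero, Option.some.injEq] at hi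
      subst hi
      exact .inr (by simp [apply])

/-- A call in progress has a beginning, and the process has not returned from a call since. -/
theorem exists_invoke_of_pending (hH : A.Valid A.initConfig H)
    (h : (A.after H).pending q = some o) :
    ∃ i : ℕ, H[i]? = some (Event.invoke q o) ∧
      ∀ j > i, ∀ o' b, H[j]? ≠ some (Event.ret q o' b) := by
  induction H using List.reverseRecOn with
  | nil => simp [after, initConfig] at h
  | append_singleton H e ih =>
    rw [valid_append] at hH
    obtain ⟨hH, he, -⟩ := hH
    change A.Enabled (A.after H) e at he
    rw [after_append] at h
    simp only [exec_cons, exec_nil] at h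
    have key : (∀ o' b, e ≠ .ret q o' b) → (A.after H).pending q = some o →
        ∃ i : ℕ, (H ++ [e])[i]? = some (Event.invoke q o) ∧
          ∀ j > i, ∀ o' b, (H ++ [e])[j]? ≠ some (Event.ret q o' b) := by
      intro hne hp
      obtain ⟨i, hi, hj⟩ := ih hH hp
      refine ⟨i, by rwa [List.getElem?_append_left (List.getElem?_eq_some_iff.mp hi).1], ?_⟩
      intro j hij o' b hjb
      rcases lt_or_ge j H.length with hlt | hge
      · rw [List.getElem?_append_left hlt] at hjb
        exact hj j hij o' b hjb
      · rw [List.getElem?_append_right hge] at hjb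
        have := List.mem_of_getElem? hjb
        simp only [List.mem_singleton] at this
        exact hne o' b this.symm
    by_cases hq : e.proc = q
    · cases e with
      | invoke p o' =>
        subst hq
        obtain rfl : o' = o := by simpa [apply, Event.proc] using h
        refine ⟨H.length, by simp [Event.proc], fun j hj o'' b hjb => ?_⟩
        have := (List.getElem?_eq_some_iff.mp hjb).1
        simp at this; omega
      | read p v x => exact key (by simp) h
      | write p v x => exact key (by simp) h
      | ret p o' b => subst hq; simp [apply, Event.proc] at h
    · refine key ?_ (by rwa [apply_pending_of_ne hq] at h)
      rintro o' b rfl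
      exact hq rfl

end Algorithm

/-! ### Admissibility -/

section Admissible

variable {H L : List (Event N Var Val)} {e : Event N Var Val} {p : Fin N}

theorem Admissible.of_append (h : Admissible (H ++ L)) : Admissible H := by
  refine ⟨le_trans (by simp) h.1, fun p i j hij hi hj => h.2 p i j hij ?_ ?_⟩
  · rwa [List.getElem?_append_left (List.getElem?_eq_some_iff.mp hi).1]
  · rwa [List.getElem?_append_left (List.getElem?_eq_some_iff.mp hj).1]

theorem Admissible.snoc (h : Admissible H)
    (h1 : e.isSignalInvoke = true → ∀ e ∈ H, e.isSignalInvoke = false)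
    (h2 : ∀ p, e = .invoke p .poll → .ret p .poll true ∉ H) : Admissible (H ++ [e]) := by
  constructor
  · rw [List.countP_append]
    cases he : e.isSignalInvoke with
    | false => simpa [he] using h.1
    | true => simpa [he] using h1 he
  · intro p i j hij hi hj
    have hjl := (List.getElem?_eq_some_iff.mp hj).1
    have hil : i < H.length := by simp at hjl; omega
    rw [List.getElem?_append_left hil] at hi
    rcases lt_or_ge j H.length with hlt | hge
    · rw [List.getElem?_append_left hlt] at hj
      exact h.2 p i j hij hi hj
    · rw [List.getElem?_append_right hge] at hj
      have := List.mem_of_getElem? hj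
      simp only [List.mem_singleton] at this
      exact h2 p this.symm (List.mem_of_getElem? hi)

theorem Admissible.snoc_of_not_invoke (h : Admissible H) (he : ∀ p o, e ≠ .invoke p o) :
    Admissible (H ++ [e]) :=
  h.snoc (fun h => by cases e <;> simp_all [Event.isSignalInvoke]) fun p hp => absurd hp (he _ _)

end Admissible

namespace Algorithm

variable {A : Algorithm N Var Val Loc} {e : Event N Var Val}
  {H L : List (Event N Var Val)} {p q : Fin N} {o : Op}

/-- A completed call at the end of a history, as an instance of `IsCall`. -/
theorem exists_isCall {b : Bool} (hH : A.Valid A.initConfig (H ++ .ret p o b :: L)) :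
    ∃ i, IsCall (H ++ .ret p o b :: L) p o i H.length b := by
  rw [valid_append] at hH
  obtain ⟨i, hi, hj⟩ := exists_invoke_of_pending hH.1 hH.2.1.1
  have hlt := (List.getElem?_eq_some_iff.mp hi).1
  refine ⟨i, hlt, by rwa [List.getElem?_append_left hlt], by simp, fun m h1 h2 o' b' => ?_⟩
  rw [List.getElem?_append_left h2]
  exact hj m h1 o' b'

/-- Without a signal, no call to `poll` returns `true`. -/
theorem SolvesSignaling.ret_true_notMem (hA : A.SolvesSignaling) (hH : H ∈ A.histories)
    (hs : ∀ e ∈ H, e.isSignalInvoke = false) : .ret p .poll true ∉ H := by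
  intro hmem
  obtain ⟨H₁, H₂, rfl⟩ := List.append_of_mem hmem
  obtain ⟨i, hi⟩ := exists_isCall (mem_histories.mp hH).1
  obtain ⟨m, -, q, hq⟩ := (hA _ hH).1 p i _ hi
  exact absurd (hs _ (List.mem_of_getElem? hq)) (by simp [Event.isSignalInvoke])

theorem histories_of_append (h : H ++ L ∈ A.histories) : H ∈ A.histories := by
  rw [mem_histories, valid_append] at h
  exact mem_histories.mpr ⟨h.1.1, h.2.of_append⟩

theorem histories_append_of_not_invoke (h : H ∈ A.histories) (hL : ∀ e ∈ L, ∀ p o, e ≠ .invoke p o)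
    (hv : A.Valid (A.after H) L) : H ++ L ∈ A.histories := by
  induction L using List.reverseRecOn with
  | nil => simpa
  | append_singleton L e ih =>
    rw [valid_append] at hv
    have := mem_histories.mp (ih (fun e he => hL e (by simp [he])) hv.1)
    rw [← List.append_assoc, mem_histories]
    refine ⟨valid_append.mpr ⟨this.1, ?_⟩, this.2.snoc_of_not_invoke (hL e (by simp))⟩
    have h2 := hv.2
    rwa [← after_append] at h2

end Algorithm

/-! ### Running alone -/

namespace Algorithm

variable {A : Algorithm N Var Val Loc} {C : Config N Var Val Loc} {e : Event N Var Val}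
  {H L : List (Event N Var Val)} {p q : Fin N} {o : Op}

/-- The next event of process `p` in configuration `C` while it executes a call to `o`. -/
def nextEvent (A : Algorithm N Var Val Loc) (p : Fin N) (o : Op) (C : Config N Var Val Loc) :
    Event N Var Val :=
  match A.act p (C.loc p) with
  | .read v _ => .read p v (C.mem v)
  | .write v x _ => .write p v x
  | .ret b _ => .ret p o b

theorem nextEvent_proc : (A.nextEvent p o C).proc = p := by
  unfold nextEvent; split <;> rfl

theorem enabled_nextEvent (h : C.pending p = some o) : A.Enabled C (A.nextEvent p o C) := by
  unfold nextEvent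
  split
  case h_1 v next ha => exact ⟨by simp [h], ⟨next, ha⟩, rfl⟩
  case h_2 v x next ha => exact ⟨by simp [h], next, ha⟩
  case h_3 b next ha => exact ⟨h, next, ha⟩

theorem nextEvent_eq_ret (h : (A.nextEvent p o C).target = none) :
    ∃ b, A.nextEvent p o C = .ret p o b := by
  unfold nextEvent at *
  split at h <;> simp_all [Event.target]

/-- The configurations of the run in which only `p` takes steps, beginning in `C`. -/
noncomputable def soloConfig (A : Algorithm N Var Val Loc) (p : Fin N) (o : Op)
    (C : Config N Var Val Loc) : ℕ → Config N Var Val Loc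
  | 0 => C
  | n + 1 => A.apply (soloConfig A p o C n) (A.nextEvent p o (soloConfig A p o C n))

theorem solo_valid (h : C.pending p = some o) {n : ℕ}
    (hn : ∀ m < n, (A.nextEvent p o (A.soloConfig p o C m)).target ≠ none) :
    A.Valid C ((List.range n).map fun m => A.nextEvent p o (A.soloConfig p o C m)) ∧
      A.exec C ((List.range n).map fun m => A.nextEvent p o (A.soloConfig p o C m)) =
        A.soloConfig p o C n ∧ (A.soloConfig p o C n).pending p = some o := by
  induction n with
  | zero => exact ⟨trivial, rfl, h⟩
  | succ n ih =>
    obtain ⟨h1, h2, h3⟩ := ih fun m hm => hn m (by omega)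
    rw [List.range_succ, List.map_append, valid_append, exec_append, h2]
    refine ⟨⟨h1, enabled_nextEvent h3, trivial⟩, rfl, ?_⟩
    rw [soloConfig, apply_pending_of_target (hn n (by omega)), h3]

/-- If every other process is between calls, then a process that runs alone completes its call: the
others may be considered terminated, and the run is fair. -/
theorem Terminating.solo_completes (hT : A.Terminating) (hH : H ∈ A.histories)
    (hp : (A.after H).pending p = some o) (hq : ∀ q ≠ p, (A.after H).pending q = none) :
    ∃ L b, (∀ e ∈ L, e.proc = p ∧ e.target ≠ none) ∧ A.Valid (A.after H) (L ++ [.ret p o b]) := by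
  classical
  set ev : ℕ → Event N Var Val := fun m => A.nextEvent p o (A.soloConfig p o (A.after H) m)
    with hev
  by_cases hex : ∃ n, (ev n).target = none
  · have hn : ∀ m < Nat.find hex, (ev m).target ≠ none := fun m hm => Nat.find_min hex hm
    obtain ⟨h1, h2, h3⟩ := solo_valid hp hn
    obtain ⟨b, hb⟩ := nextEvent_eq_ret (Nat.find_spec hex)
    refine ⟨(List.range (Nat.find hex)).map ev, b, ?_, valid_append.mpr ⟨h1, ?_⟩⟩
    · intro e he
      obtain ⟨m, hm, rfl⟩ := List.mem_map.mp he
      exact ⟨nextEvent_proc, hn m (List.mem_range.mp hm)⟩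
    · rw [h2, ← hb]
      exact ⟨enabled_nextEvent h3, trivial⟩
  · exfalso
    push Not at hex
    set σ : ℕ → Event N Var Val := fun n => if h : n < H.length then H[n] else ev (n - H.length)
      with hσ
    have hlt : ∀ n, n < H.length → H[n]? = some (σ n) := fun n hn => by simp [hσ, hn]
    have hge : ∀ n, H.length ≤ n → σ n = ev (n - H.length) := fun n hn => by
      simp [hσ, Nat.not_lt.mpr hn]
    have hproc : ∀ n, (ev n).proc = p := fun n => nextEvent_proc
    have hret : ∀ n q o b, ev n ≠ .ret q o b := fun n q o b h => hex n (by rw [h]; rfl)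
    have hinv : ∀ n q o, ev n ≠ .invoke q o := fun n q o h => hex n (by rw [h]; rfl)
    have hadm : ∀ n, (List.range n).map σ ∈ A.histories := by
      intro n
      have h1 : H ++ (List.range n).map ev ∈ A.histories := by
        refine histories_append_of_not_invoke hH ?_ (solo_valid hp fun m _ => hex m).1
        intro e he
        obtain ⟨m, -, rfl⟩ := List.mem_map.mp he
        exact hinv m
      have h2 : (List.range n).map σ = (H ++ (List.range n).map ev).take n := by
        refine List.ext_getElem? fun i => ?_
        rw [List.getElem?_take]
        split_ifs with hi
        · rcases lt_or_ge i H.length with hl | hg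
          · rw [List.getElem?_append_left hl, hlt i hl]
            simp [hi]
          · rw [List.getElem?_append_right hg]
            have : i - H.length < n := by omega
            simp [hi, hge i hg, this]
        · simpa using hi
      rw [h2]
      refine histories_of_append (L := (H ++ (List.range n).map ev).drop n) ?_
      rwa [List.take_append_drop]
    have hfair : FairCrashFree σ := by
      intro q
      by_cases hqp : q = p
      · subst hqp
        refine .inl fun n => ⟨n + H.length, by omega, ?_⟩
        rw [hge _ (by omega)]
        exact hproc _
      · refine .inr ⟨⟨H.length, fun m hm => ?_⟩, fun i o' hi => ?_⟩
        · rw [hge m hm, hproc]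
          exact Ne.symm hqp
        · rcases lt_or_ge i H.length with hl | hg
          · rcases ret_or_pending (mem_histories.mp hH).1 ((hlt i hl).trans (congrArg some hi)) with
              ⟨j, hj, b, hb⟩ | hpend
            · refine ⟨j, hj, b, ?_⟩
              have hjl := (List.getElem?_eq_some_iff.mp hb).1
              exact Option.some.inj ((hlt j hjl).symm.trans hb)
            · rw [hq q hqp] at hpend
              simp at hpend
          · rw [hge i hg] at hi
            exact absurd hi (hinv _ _ _)
    obtain ⟨i, hi, hno⟩ := exists_invoke_of_pending (mem_histories.mp hH).1 hp
    have hil := (List.getElem?_eq_some_iff.mp hi).1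
    obtain ⟨j, hj, b, hb⟩ := hT σ hadm hfair p i o (Option.some.inj ((hlt i hil).symm.trans hi))
    rcases lt_or_ge j H.length with hl | hg
    · exact hno j hj o b ((hlt j hl).trans (congrArg some hb))
    · rw [hge j hg] at hb
      exact hret _ _ _ _ hb

end Algorithm

/-! ### Erasing processes -/

/-- The events of the processes in `T`; all other processes are erased from the history. -/
def proj (T : Finset (Fin N)) (H : List (Event N Var Val)) : List (Event N Var Val) :=
  H.filter fun e => decide (e.proc ∈ T)

theorem proj_append {T : Finset (Fin N)} {H L : List (Event N Var Val)} :
    proj T (H ++ L) = proj T H ++ proj T L := List.filter_append ..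

theorem proj_eq_self {T : Finset (Fin N)} {L : List (Event N Var Val)}
    (h : ∀ e ∈ L, e.proc ∈ T) : proj T L = L := by
  simpa [proj] using h

theorem proj_eq_nil {T : Finset (Fin N)} {L : List (Event N Var Val)}
    (h : ∀ e ∈ L, e.proc ∉ T) : proj T L = [] := by
  simpa [proj] using h

theorem proc_mem_of_mem_proj {T : Finset (Fin N)} {H : List (Event N Var Val)}
    {e : Event N Var Val} (h : e ∈ proj T H) : e.proc ∈ T := by
  simpa using List.of_mem_filter h

theorem mem_of_mem_proj {T : Finset (Fin N)} {H : List (Event N Var Val)}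
    {e : Event N Var Val} (h : e ∈ proj T H) : e ∈ H :=
  List.mem_of_mem_filter h

namespace Algorithm

/-- The configuration reached when all processes outside `T` are erased from `H`. -/
noncomputable def cfg (A : Algorithm N Var Val Loc) (H : List (Event N Var Val))
    (T : Finset (Fin N)) : Config N Var Val Loc :=
  A.after (proj T H)

variable {A : Algorithm N Var Val Loc} {C : Config N Var Val Loc} {e : Event N Var Val}
  {H L : List (Event N Var Val)} {p q w : Fin N} {o : Op} {T : Finset (Fin N)}

theorem cfg_append_of_mem (h : ∀ e ∈ L, e.proc ∈ T) :
    A.cfg (H ++ L) T = A.exec (A.cfg H T) L := by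
  rw [cfg, proj_append, proj_eq_self h, after_append, cfg]

theorem cfg_snoc_of_mem (h : e.proc ∈ T) :
    A.cfg (H ++ [e]) T = A.apply (A.cfg H T) e := by
  rw [cfg_append_of_mem (by simpa using h)]; rfl

theorem cfg_snoc_of_notMem (h : e.proc ∉ T) : A.cfg (H ++ [e]) T = A.cfg H T := by
  rw [cfg, proj_append, proj_eq_nil (L := [e]) (by simpa using h), List.append_nil, cfg]

theorem cfg_pending_of_notMem (h : q ∉ T) : (A.cfg H T).pending q = none :=
  exec_pending_of_ne fun _ he hq => h (hq ▸ proc_mem_of_mem_proj he)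

/-- The processes in `act` are invisible after the history `H`: any set of them can be erased, and
the others, as well as the processes in `fin`, do not notice. More precisely, let `H` be restricted
to the processes in `S ∪ fin`, where `S ⊆ act`. The result is a history, the local states of the
remaining processes do not depend on `S`, and the value of a variable `v` depends at most on whether
`dep v` (its last writer, or its owner) belongs to `S`. This is not required of the variables in
`X`, which must not be read; in the case of interest `X` is empty. The variables that reside in the
module of a process in `act` depend on that process only. -/
structure Family (A : Algorithm N Var Val Loc) (X : Set Var) (act fin : Finset (Fin N))
    (dep : Var → Fin N) (H : List (Event N Var Val)) : Prop where
  disj : ∀ p ∈ act, p ∉ fin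
  hist : ∀ S ⊆ act, proj (S ∪ fin) H ∈ A.histories
  loc : ∀ S ⊆ act, ∀ S' ⊆ act, ∀ p ∈ S ∪ fin, p ∈ S' ∪ fin →
    (A.cfg H (S ∪ fin)).loc p = (A.cfg H (S' ∪ fin)).loc p
  pending : ∀ S ⊆ act, ∀ S' ⊆ act, ∀ p ∈ S ∪ fin, p ∈ S' ∪ fin →
    (A.cfg H (S ∪ fin)).pending p = (A.cfg H (S' ∪ fin)).pending p
  mem : ∀ S ⊆ act, ∀ S' ⊆ act, ∀ v ∉ X, (dep v ∈ S ↔ dep v ∈ S') →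
    (A.cfg H (S ∪ fin)).mem v = (A.cfg H (S' ∪ fin)).mem v
  own : ∀ v, A.owner v ∈ act → v ∉ X ∧ dep v = A.owner v

namespace Family

variable {X : Set Var} {act act' fin : Finset (Fin N)} {dep : Var → Fin N}

theorem init : A.Family ∅ Finset.univ ∅ A.owner [] where
  disj := by simp
  hist S _ := mem_histories.mpr ⟨trivial, by simp [Admissible, proj]⟩
  loc _ _ _ _ _ _ _ := rfl
  pending _ _ _ _ _ _ _ := rfl
  mem _ _ _ _ _ _ _ := rfl
  own _ _ := ⟨id, rfl⟩

theorem erase (h : A.Family X act fin dep H) (hs : act' ⊆ act) : A.Family X act' fin dep H where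
  disj p hp := h.disj p (hs hp)
  hist S hS := h.hist S (hS.trans hs)
  loc S hS S' hS' := h.loc S (hS.trans hs) S' (hS'.trans hs)
  pending S hS S' hS' := h.pending S (hS.trans hs) S' (hS'.trans hs)
  mem S hS S' hS' := h.mem S (hS.trans hs) S' (hS'.trans hs)
  own v hv := h.own v (hs hv)

/-- Process `w` gives up invisibility: it can no longer be erased. -/
theorem promote (h : A.Family X act fin dep H) (hw : w ∈ act) :
    A.Family X (act.erase w) (insert w fin) dep H := by
  have hsub : ∀ {S}, S ⊆ act.erase w → insert w S ⊆ act := fun hS =>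
    Finset.insert_subset hw (hS.trans (Finset.erase_subset _ _))
  have hun : ∀ S : Finset (Fin N), S ∪ insert w fin = insert w S ∪ fin := fun S => by
    rw [Finset.union_insert, Finset.insert_union]
  refine ⟨?_, ?_, ?_, ?_, ?_, ?_⟩
  · intro p hp
    rw [Finset.mem_erase] at hp
    simp [hp.1, h.disj p hp.2]
  · intro S hS
    rw [hun]
    exact h.hist _ (hsub hS)
  · intro S hS S' hS'
    rw [hun, hun]
    exact h.loc _ (hsub hS) _ (hsub hS')
  · intro S hS S' hS'
    rw [hun, hun]
    exact h.pending _ (hsub hS) _ (hsub hS')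
  · intro S hS S' hS' v hv hd
    rw [hun, hun]
    refine h.mem _ (hsub hS) _ (hsub hS') v hv ?_
    simp [hd]
  · intro v hv
    exact h.own v (Finset.mem_of_mem_erase hv)

/-- The view of an invisible process does not depend on the other invisible processes. -/
theorem view (h : A.Family X act fin dep H) {S S' : Finset (Fin N)} (hS : S ⊆ act) (hS' : S' ⊆ act)
    (hp : p ∈ S) (hp' : p ∈ S') : A.SameView p (A.cfg H (S ∪ fin)) (A.cfg H (S' ∪ fin)) where
  loc := h.loc S hS S' hS' p (by simp [hp]) (by simp [hp'])
  pending := h.pending S hS S' hS' p (by simp [hp]) (by simp [hp'])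
  mem v hv := by
    obtain ⟨h1, h2⟩ := h.own v (hv ▸ hS hp)
    exact h.mem S hS S' hS' v h1 (by simp [h2, hv, hp, hp'])

/-- A step that reads no variable that depends on another invisible process is possible, with the
same effect, however the other processes are erased. -/
theorem enabled (h : A.Family X act fin dep H) {S S' : Finset (Fin N)} (hS : S ⊆ act)
    (hS' : S' ⊆ act) (hp : e.proc ∈ S ∪ fin) (hp' : e.proc ∈ S' ∪ fin)
    (hread : ∀ p v x, e = .read p v x → v ∉ X ∧ (dep v = p ∨ dep v ∉ act))
    (he : A.Enabled (A.cfg H (S ∪ fin)) e) : A.Enabled (A.cfg H (S' ∪ fin)) e := by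
  have h1 := h.loc S hS S' hS' _ hp hp'
  have h2 := h.pending S hS S' hS' _ hp hp'
  cases e with
  | invoke p o => exact h2.symm.trans he
  | ret p o b =>
    refine ⟨h2.symm.trans he.1, ?_⟩
    rw [← show _ = (A.cfg H (S' ∪ fin)).loc p from h1]
    exact he.2
  | write p v x =>
    refine ⟨fun hn => he.1 (h2.trans hn), ?_⟩
    rw [← show _ = (A.cfg H (S' ∪ fin)).loc p from h1]
    exact he.2
  | read p v x =>
    refine ⟨fun hn => he.1 (h2.trans hn), ?_, he.2.2.trans ?_⟩
    · rw [← show _ = (A.cfg H (S' ∪ fin)).loc p from h1]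
      exact he.2.1
    · obtain ⟨hX, hd⟩ := hread p v x rfl
      refine h.mem S hS S' hS' v hX ?_
      change p ∈ S ∪ fin at hp
      change p ∈ S' ∪ fin at hp'
      rcases hd with hd | hd
      · rw [hd]
        by_cases hf : p ∈ fin
        · exact iff_of_false (fun hc => h.disj p (hS hc) hf) (fun hc => h.disj p (hS' hc) hf)
        · simp only [Finset.mem_union, hf, or_false] at hp hp'
          exact iff_of_true hp hp'
      · exact iff_of_false (fun hc => hd (hS hc)) (fun hc => hd (hS' hc))

/-- A step of a process that belongs to `act` or to `fin`. It must not read a variable that depends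
on another invisible process, or one in `X`. A written variable may become an element of `X'`.
Otherwise it depends on the writer; unless the writer belongs to `fin`, its previous value, which
is seen when the writer is erased, must not have depended on another invisible process. -/
theorem step {X' : Set Var} {dep' : Var → Fin N} (h : A.Family X act fin dep H)
    {S₀ : Finset (Fin N)} (hS₀ : S₀ ⊆ act)
    (hp : e.proc ∈ S₀ ∪ fin) (he : A.Enabled (A.cfg H (S₀ ∪ fin)) e)
    (hread : ∀ p v x, e = .read p v x → v ∉ X ∧ (dep v = p ∨ dep v ∉ act))
    (hwrite : ∀ p v x, e = .write p v x → (A.owner v ∈ act → v ∉ X' ∧ dep' v = A.owner v) ∧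
      (v ∉ X' → dep' v = p ∧ (p ∈ fin ∨ v ∉ X ∧ (dep v = p ∨ dep v ∉ act))))
    (hother : ∀ v, (∀ p x, e ≠ .write p v x) → (v ∈ X ↔ v ∈ X') ∧ dep' v = dep v)
    (hadm : ∀ S ⊆ act, e.proc ∈ S ∪ fin → Admissible (proj (S ∪ fin) H ++ [e])) :
    A.Family X' act fin dep' (H ++ [e]) := by
  have hen : ∀ S ⊆ act, e.proc ∈ S ∪ fin → A.Enabled (A.cfg H (S ∪ fin)) e :=
    fun S hS hpS => h.enabled hS₀ hS hp hpS hread he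
  refine ⟨h.disj, ?_, ?_, ?_, ?_, ?_⟩
  · intro S hS
    rw [proj_append]
    by_cases hpS : e.proc ∈ S ∪ fin
    · rw [proj_eq_self (L := [e]) (by simpa using hpS)]
      exact mem_histories.mpr ⟨valid_append.mpr
        ⟨(mem_histories.mp (h.hist S hS)).1, hen S hS hpS, trivial⟩, hadm S hS hpS⟩
    · rw [proj_eq_nil (L := [e]) (by simpa using hpS), List.append_nil]
      exact h.hist S hS
  · intro S hS S' hS' q hq hq'
    have h0 := h.loc S hS S' hS' q hq hq'
    by_cases hqe : e.proc = q
    · subst hqe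
      rw [cfg_snoc_of_mem hq, cfg_snoc_of_mem hq']
      cases e <;> simp only [Event.proc] at * <;> simp [Algorithm.apply, h0]
    · have key : ∀ T, (A.cfg (H ++ [e]) T).loc q = (A.cfg H T).loc q := by
        intro T
        by_cases hT : e.proc ∈ T
        · rw [cfg_snoc_of_mem hT, apply_loc_of_ne hqe]
        · rw [cfg_snoc_of_notMem hT]
      rw [key, key, h0]
  · intro S hS S' hS' q hq hq'
    have h0 := h.pending S hS S' hS' q hq hq'
    by_cases hqe : e.proc = q
    · subst hqe
      rw [cfg_snoc_of_mem hq, cfg_snoc_of_mem hq']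
      cases e <;> simp only [Event.proc] at * <;> simp [Algorithm.apply, h0]
    · have key : ∀ T, (A.cfg (H ++ [e]) T).pending q = (A.cfg H T).pending q := by
        intro T
        by_cases hT : e.proc ∈ T
        · rw [cfg_snoc_of_mem hT, apply_pending_of_ne hqe]
        · rw [cfg_snoc_of_notMem hT]
      rw [key, key, h0]
  · intro S hS S' hS' v hv hd
    by_cases hw : ∀ p x, e ≠ .write p v x
    · obtain ⟨hX, hdep⟩ := hother v hw
      have key : ∀ T, (A.cfg (H ++ [e]) T).mem v = (A.cfg H T).mem v := by
        intro T
        by_cases hT : e.proc ∈ T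
        · rw [cfg_snoc_of_mem hT]
          cases e with
          | write p u x =>
            refine apply_mem_of_ne fun hc => ?_
            obtain rfl : u = v := Option.some.inj hc
            exact hw p x rfl
          | _ => rfl
        · rw [cfg_snoc_of_notMem hT]
      rw [key, key]
      exact h.mem S hS S' hS' v (fun hc => hv (hX.mp hc)) (by rwa [hdep] at hd)
    · push Not at hw
      obtain ⟨p, x, rfl⟩ := hw
      obtain ⟨hdep, hcase⟩ := (hwrite p v x rfl).2 hv
      rw [hdep] at hd
      change p ∈ S₀ ∪ fin at hp
      have key : ∀ T, p ∈ T → (A.cfg (H ++ [.write p v x]) T).mem v = x := by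
        intro T hT
        rw [cfg_snoc_of_mem hT]
        simp [Algorithm.apply]
      by_cases hpS : p ∈ S ∪ fin
      · have hpS' : p ∈ S' ∪ fin := by
          simp only [Finset.mem_union] at hpS ⊢
          rwa [← hd]
        rw [key _ hpS, key _ hpS']
      · have hpS' : p ∉ S' ∪ fin := by
          simp only [Finset.mem_union] at hpS ⊢
          rwa [← hd]
        rw [cfg_snoc_of_notMem (by exact hpS), cfg_snoc_of_notMem (by exact hpS')]
        rcases hcase with hf | ⟨hX, hc⟩
        · exact absurd (Finset.mem_union_right _ hf) hpS
        · refine h.mem S hS S' hS' v hX ?_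
          rcases hc with hc | hc
          · rwa [hc]
          · exact iff_of_false (fun hs => hc (hS hs)) (fun hs => hc (hS' hs))
  · intro v hv
    by_cases hw : ∀ p x, e ≠ .write p v x
    · obtain ⟨hX, hdep⟩ := hother v hw
      rw [hdep, ← hX]
      exact h.own v hv
    · push Not at hw
      obtain ⟨p, x, rfl⟩ := hw
      exact (hwrite p v x rfl).1 hv

end Family
end Algorithm

/-! ### Runs of invisible and of visible processes -/

/-- No call to `signal` has begun. -/
def NoSignal (H : List (Event N Var Val)) : Prop := ∀ e ∈ H, e.isSignalInvoke = false

namespace Algorithm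

variable {A : Algorithm N Var Val Loc} {C : Config N Var Val Loc} {e : Event N Var Val}
  {H L : List (Event N Var Val)} {p q w : Fin N} {o : Op} {T : Finset (Fin N)}

theorem cfg_append_of_notMem (h : ∀ e ∈ L, e.proc ∉ T) : A.cfg (H ++ L) T = A.cfg H T := by
  rw [cfg, proj_append, proj_eq_nil h, List.append_nil, cfg]

open Classical in
/-- How the last writers of the variables change with an event. -/
noncomputable def newDep (dep : Var → Fin N) : Event N Var Val → Var → Fin N
  | .write p v _ => Function.update dep v p
  | _ => dep

theorem newDep_of_ne {dep : Var → Fin N} {v : Var} (h : ∀ p x, e ≠ .write p v x) :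
    newDep dep e v = dep v := by
  cases e with
  | write p u x =>
    have : v ≠ u := by
      rintro rfl
      exact h p x rfl
    simp [newDep, this]
  | _ => rfl

theorem newDep_eq_or {dep : Var → Fin N} {v : Var} :
    newDep dep e v = dep v ∨ newDep dep e v = e.proc := by
  by_cases h : ∀ p x, e ≠ .write p v x
  · exact .inl (newDep_of_ne h)
  · push Not at h
    obtain ⟨p, x, rfl⟩ := h
    exact .inr (by simp [newDep, Event.proc])

namespace Family

variable {X : Set Var} {act act' fin : Finset (Fin N)} {dep : Var → Fin N}

theorem admissible_of_not_invoke (h : A.Family X act fin dep H) (he : ∀ p o, e ≠ .invoke p o)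
    {S : Finset (Fin N)} (hS : S ⊆ act) : Admissible (proj (S ∪ fin) H ++ [e]) :=
  (mem_histories.mp (h.hist S hS)).2.snoc_of_not_invoke he

theorem admissible_of_noSignal (hA : A.SolvesSignaling) (h : A.Family X act fin dep H)
    (hH : NoSignal H) {S : Finset (Fin N)} (hS : S ⊆ act) :
    Admissible (proj (S ∪ fin) H ++ [e]) := by
  have hns : NoSignal (proj (S ∪ fin) H) := fun e he => hH e (mem_of_mem_proj he)
  exact (mem_histories.mp (h.hist S hS)).2.snoc (fun _ => hns)
    fun p _ => hA.ret_true_notMem (h.hist S hS) hns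

/-- A step that accesses no variable that depends on another invisible process preserves
invisibility. -/
theorem step_clean (h : A.Family ∅ act fin dep H) {S₀ : Finset (Fin N)} (hS₀ : S₀ ⊆ act)
    (hp : e.proc ∈ S₀ ∪ fin) (he : A.Enabled (A.cfg H (S₀ ∪ fin)) e)
    (hacc : ∀ v, e.target = some v → dep v = e.proc ∨ dep v ∉ act)
    (hadm : ∀ S ⊆ act, Admissible (proj (S ∪ fin) H ++ [e])) :
    A.Family ∅ act fin (newDep dep e) (H ++ [e]) := by
  refine h.step hS₀ hp he ?_ ?_ (fun v hv => ⟨Iff.rfl, newDep_of_ne hv⟩) (fun S hS _ => hadm S hS)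
  · rintro p v x rfl
    exact ⟨id, hacc v rfl⟩
  · rintro p v x rfl
    have hd : newDep dep (.write p v x : Event N Var Val) v = p := by simp [newDep]
    rw [hd]
    refine ⟨fun hv => ⟨id, ?_⟩, fun _ => ⟨rfl, .inr ⟨id, hacc v rfl⟩⟩⟩
    have ho := (h.own v hv).2
    rcases hacc v rfl with h1 | h1
    · exact h1.symm.trans ho
    · exact absurd (ho ▸ hv) h1

/-- Steps without remote memory references preserve invisibility. -/
theorem push_local (hA : A.SolvesSignaling) (h : A.Family ∅ act fin dep H) (hH : NoSignal H)
    (hp : p ∈ act) (hL : ∀ e ∈ L, A.IsLocal p e) (hv : A.Valid (A.cfg H (act ∪ fin)) L) :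
    A.Family ∅ act fin dep (H ++ L) := by
  induction L generalizing H with
  | nil => simpa
  | cons e L ih =>
    have he := hL e (by simp)
    have hpe : e.proc ∈ act ∪ fin := by simp [he.proc, hp]
    have hdep : ∀ v, e.target = some v → dep v = e.proc := by
      intro v hv
      have ho := owner_of_not_rmr he.rmr hv
      rw [(h.own v (by rw [ho, he.proc]; exact hp)).2, ho]
    have h1 := h.step_clean subset_rfl hpe hv.1 (fun v hv => .inl (hdep v hv))
      fun S hS => h.admissible_of_noSignal hA hH hS
    have h2 : newDep dep e = dep := by
      funext v
      by_cases hw : ∀ p x, e ≠ .write p v x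
      · exact newDep_of_ne hw
      · push Not at hw
        obtain ⟨p, x, rfl⟩ := hw
        simp [newDep, hdep v rfl, Event.proc]
    rw [h2] at h1
    rw [List.append_cons]
    refine ih h1 ?_ (fun e he => hL e (by simp [he])) ?_
    · intro e' he'
      rcases List.mem_append.mp he' with h' | h'
      · exact hH e' h'
      · rw [List.mem_singleton.mp h']
        exact he.signal
    · rw [cfg_snoc_of_mem hpe]
      exact hv.2

/-- Steps of a visible process preserve the invisibility of the others if, before each access to a
variable that depends on an invisible process, that process is erased. Such an access is a remote
memory reference. -/
theorem push_visible (h : A.Family ∅ act fin dep H) (hw : w ∈ fin)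
    (hL : ∀ e ∈ L, e.proc = w ∧ ∀ p o, e ≠ .invoke p o) (hv : A.Valid (A.cfg H fin) L)
    (hown : ∀ v, A.owner v = w → dep v ∉ act) :
    ∃ act' ⊆ act, act.card ≤ act'.card + L.countP A.isRMR ∧ ∃ dep',
      A.Family ∅ act' fin dep' (H ++ L) ∧
      ∀ p ∈ act', A.SameView p (A.cfg (H ++ L) (act' ∪ fin)) (A.cfg H (act ∪ fin)) := by
  induction L generalizing H act dep with
  | nil => exact ⟨act, subset_rfl, by simp, dep, by simpa, fun p _ => by simpa using .refl⟩
  | cons e L ih =>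
    obtain ⟨hew, hei⟩ := hL e (by simp)
    obtain ⟨act₁, hsub, hcard, hcl⟩ : ∃ act₁ ⊆ act, act.card ≤ act₁.card +
        (if A.isRMR e then 1 else 0) ∧ ∀ v, e.target = some v → dep v ∉ act₁ := by
      by_cases hx : ∃ v, e.target = some v ∧ dep v ∈ act
      · obtain ⟨v, hv, hd⟩ := hx
        refine ⟨act.erase (dep v), Finset.erase_subset _ _, ?_, fun v' hv' => ?_⟩
        · have : A.isRMR e = true := by
            by_contra hr
            exact hown v ((owner_of_not_rmr (by simpa using hr) hv).trans hew) hd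
          rw [if_pos this, Finset.card_erase_add_one hd]
        · obtain rfl : v = v' := Option.some.inj (hv.symm.trans hv')
          simp
      · push Not at hx
        exact ⟨act, subset_rfl, by omega, hx⟩
    have hwf : e.proc ∈ ∅ ∪ fin := by simp [hew, hw]
    have hf₁ := h.erase hsub
    have h1 := hf₁.step_clean (Finset.empty_subset _) hwf (by simpa using hv.1)
      (fun v hv => .inr (hcl v hv)) fun S hS => hf₁.admissible_of_not_invoke hei hS
    have hown₁ : ∀ v, A.owner v = w → newDep dep e v ∉ act₁ := by
      intro v hv
      rcases newDep_eq_or (dep := dep) (e := e) (v := v) with h2 | h2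
      · rw [h2]
        exact fun hc => hown v hv (hsub hc)
      · rw [h2, hew]
        exact fun hc => h.disj w (hsub hc) hw
    obtain ⟨act', hsub', hcard', dep', hfam, hview⟩ := ih h1 (fun e he => hL e (by simp [he]))
      (by rw [cfg_snoc_of_mem (by simpa [hew] using hw)]; exact hv.2) hown₁
    rw [← List.append_cons] at hfam hview
    refine ⟨act', hsub'.trans hsub, ?_, dep', hfam, fun p hp => ?_⟩
    · rw [List.countP_cons]
      omega
    · have hpa := hsub' hp
      refine (hview p hp).trans (.trans ?_ (h.view hsub subset_rfl hpa (hsub hpa)))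
      rw [cfg_snoc_of_mem (by simp [hew, hw])]
      refine sameView_apply_of_ne ?_ fun v hv ho => ?_
      · rw [hew]
        rintro rfl
        exact h.disj _ (hsub hpa) hw
      · refine hcl v hv ?_
        rw [(hf₁.own v (ho ▸ hpa)).2, ho]
        exact hpa

/-- A visible process completes its call, at the price of erasing boundedly many invisible
processes: all of its remote memory references occur also if all invisible processes are erased. -/
theorem rollForward {c : ℕ} (hT : A.Terminating)
    (hbd : ∀ H ∈ A.histories, A.rmrCount H ≤ c * (participants H).card)
    (h : A.Family ∅ act fin dep H) (hw : w ∈ fin) (hpend : (A.cfg H fin).pending w = some o)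
    (hidle : ∀ q ∈ fin, q ≠ w → (A.cfg H fin).pending q = none)
    (hown : ∀ v, A.owner v = w → dep v ∉ act) :
    ∃ L b, (∀ e ∈ L, e.proc = w ∧ e.target ≠ none) ∧
      (∀ q ∈ fin, (A.cfg (H ++ (L ++ [.ret w o b])) fin).pending q = none) ∧
      ∃ act' ⊆ act, act.card ≤ act'.card + c * fin.card ∧ ∃ dep',
      A.Family ∅ act' fin dep' (H ++ (L ++ [.ret w o b])) ∧
      ∀ p ∈ act', A.SameView p (A.cfg (H ++ (L ++ [.ret w o b])) (act' ∪ fin))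
        (A.cfg H (act ∪ fin)) := by
  have hh : proj fin H ∈ A.histories := by simpa using h.hist ∅ (Finset.empty_subset _)
  obtain ⟨L, b, hL, hv⟩ := hT.solo_completes hh hpend fun q hq => by
    by_cases hqf : q ∈ fin
    · exact hidle q hqf hq
    · exact cfg_pending_of_notMem hqf
  have hL' : ∀ e ∈ L ++ [.ret w o b], e.proc = w ∧ ∀ p o, e ≠ .invoke p o := by
    intro e he
    rcases List.mem_append.mp he with he | he
    · refine ⟨(hL e he).1, ?_⟩
      rintro p o rfl
      exact (hL _ he).2 rfl
    · rw [List.mem_singleton.mp he]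
      exact ⟨rfl, by simp⟩
  obtain ⟨act', hsub, hcard, dep', hfam, hview⟩ := h.push_visible hw hL' hv hown
  refine ⟨L, b, hL, fun q hq => ?_, act', hsub, hcard.trans ?_, dep', hfam, hview⟩
  · by_cases hqw : q = w
    · subst hqw
      rw [cfg_append_of_mem (fun e he => (hL' e he).1 ▸ hw), exec_append]
      simp [Algorithm.apply]
    · rw [cfg_append_of_mem (fun e he => (hL' e he).1 ▸ hw),
        exec_pending_of_ne fun e he => (hL' e he).1 ▸ Ne.symm hqw]
      exact hidle q hq hqw
  · have h1 := hbd _ (histories_append_of_not_invoke hh (fun e he => (hL' e he).2) hv)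
    have h2 : participants (proj fin H ++ (L ++ [.ret w o b])) ⊆ fin := by
      intro q hq
      simp only [participants, List.mem_toFinset, List.mem_map] at hq
      obtain ⟨e, he, rfl⟩ := hq
      rcases List.mem_append.mp he with he | he
      · exact proc_mem_of_mem_proj he
      · exact (hL' e he).1 ▸ hw
    have h3 : (L ++ [Event.ret w o b]).countP A.isRMR ≤
        A.rmrCount (proj fin H ++ (L ++ [.ret w o b])) := by
      rw [rmrCount, List.countP_append (l₁ := proj fin H)]
      omega
    have h4 := Nat.mul_le_mul_left c (Finset.card_le_card h2)
    omega

end Family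

/-! ### Stages of the construction -/

/-- The number of remote memory references that `p` makes in `H`. -/
def rmrBy (A : Algorithm N Var Val Loc) (p : Fin N) (H : List (Event N Var Val)) : ℕ :=
  H.countP fun e => A.isRMR e && decide (e.proc = p)

theorem rmrBy_append : A.rmrBy p (H ++ L) = A.rmrBy p H + A.rmrBy p L := List.countP_append

/-- The situation after `i` rounds of the construction: before any signal, at most `i` processes
have become visible, all of them are between calls, and every invisible process has made at least
`i` remote memory references. -/
structure Stage (A : Algorithm N Var Val Loc) (i : ℕ) (act fin : Finset (Fin N))
    (dep : Var → Fin N) (H : List (Event N Var Val)) : Prop where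
  family : A.Family ∅ act fin dep H
  noSignal : NoSignal H
  idle : ∀ q ∈ fin, (A.cfg H fin).pending q = none
  card_fin : fin.card ≤ i
  rmr : ∀ p ∈ act, i ≤ A.rmrBy p H

namespace Stage

variable {act act' fin : Finset (Fin N)} {dep : Var → Fin N} {i : ℕ}

theorem erase (h : A.Stage i act fin dep H) (hs : act' ⊆ act) : A.Stage i act' fin dep H :=
  ⟨h.family.erase hs, h.noSignal, h.idle, h.card_fin, fun p hp => h.rmr p (hs hp)⟩

theorem push_local (hA : A.SolvesSignaling) (h : A.Stage i act fin dep H)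
    (hp : p ∈ act) (hL : ∀ e ∈ L, A.IsLocal p e) (hv : A.Valid (A.cfg H (act ∪ fin)) L) :
    A.Stage i act fin dep (H ++ L) where
  family := h.family.push_local hA h.noSignal hp hL hv
  noSignal e he := (List.mem_append.mp he).elim (h.noSignal e) fun he => (hL e he).signal
  idle q hq := by
    rw [cfg_append_of_notMem fun e he => (hL e he).proc ▸ h.family.disj p hp]
    exact h.idle q hq
  card_fin := h.card_fin
  rmr q hq := by
    rw [rmrBy_append]
    exact (h.rmr q hq).trans (Nat.le_add_right _ _)

/-- All invisible processes take steps without remote memory references, independently of each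
other. -/
theorem advance (hA : A.SolvesSignaling) (h : A.Stage i act fin dep H)
    (L : Fin N → List (Event N Var Val)) (hL : ∀ p ∈ act, ∀ e ∈ L p, A.IsLocal p e)
    (hv : ∀ p ∈ act, A.Valid (A.cfg H (act ∪ fin)) (L p)) :
    ∃ H', A.Stage i act fin dep H' ∧ ∀ p ∈ act,
      A.SameView p (A.cfg H' (act ∪ fin)) (A.exec (A.cfg H (act ∪ fin)) (L p)) := by
  suffices hT : ∀ T ⊆ act, ∃ H', A.Stage i act fin dep H' ∧
      (∀ p ∈ T, A.SameView p (A.cfg H' (act ∪ fin)) (A.exec (A.cfg H (act ∪ fin)) (L p))) ∧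
      ∀ p ∈ act, p ∉ T → A.SameView p (A.cfg H' (act ∪ fin)) (A.cfg H (act ∪ fin)) by
    obtain ⟨H', h1, h2, -⟩ := hT act subset_rfl
    exact ⟨H', h1, h2⟩
  intro T
  induction T using Finset.induction_on with
  | empty => exact fun _ => ⟨H, h, by simp, fun _ _ _ => .refl⟩
  | insert p T hpT ih =>
    intro hsub
    obtain ⟨H', h1, h2, h3⟩ := ih ((Finset.subset_insert _ _).trans hsub)
    have hp : p ∈ act := hsub (Finset.mem_insert_self _ _)
    obtain ⟨hv', hw⟩ := (h3 p hp hpT).symm.exec (hL p hp) (hv p hp)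
    have hc : A.cfg (H' ++ L p) (act ∪ fin) = A.exec (A.cfg H' (act ∪ fin)) (L p) :=
      cfg_append_of_mem fun e he => by simp [(hL p hp e he).proc, hp]
    refine ⟨H' ++ L p, h1.push_local hA hp (hL p hp) hv', fun q hq => ?_, fun q hq hqT => ?_⟩
    · rw [hc]
      rcases eq_or_ne p q with rfl | hpq
      · exact hw.symm
      · exact (sameView_exec_of_ne (hL p hp) hpq).trans
          (h2 q ((Finset.mem_insert.mp hq).resolve_left hpq.symm))
    · rw [hc]
      rw [Finset.mem_insert, not_or] at hqT
      exact (sameView_exec_of_ne (hL p hp) (Ne.symm hqT.1)).trans (h3 q hq hqT.2)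

end Stage
end Algorithm

/-! ### Choosing processes that do not interfere -/

/-- A directed graph with out-degrees at most one has a large independent set. If `I` is a largest
one, then each other vertex is the successor of a vertex of `I`, or it has its successor in `I`;
the vertices of the last kind form an independent set as well. -/
theorem exists_independent {α : Type*} [DecidableEq α] (s : Finset α) (f : α → α) :
    ∃ t ⊆ s, s.card ≤ 3 * t.card ∧ ∀ p ∈ t, ∀ q ∈ t, p ≠ q → f p ≠ q := by
  classical
  set P := s.powerset.filter fun t => ∀ p ∈ t, ∀ q ∈ t, p ≠ q → f p ≠ q with hP
  have hmem : ∀ t, t ∈ P ↔ t ⊆ s ∧ ∀ p ∈ t, ∀ q ∈ t, p ≠ q → f p ≠ q := by simp [hP]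
  obtain ⟨I, hI, hmax⟩ := P.exists_max_image Finset.card ⟨∅, by simp [hmem]⟩
  obtain ⟨hIs, hind⟩ := (hmem I).mp hI
  refine ⟨I, hIs, ?_, hind⟩
  set J := s.filter fun q => q ∉ I ∧ f q ∈ I with hJ
  have hJP : J ∈ P := (hmem J).mpr ⟨Finset.filter_subset _ _, fun p hp q hq _ hf => by
    simp only [hJ, Finset.mem_filter] at hp hq
    exact hq.2.1 (hf ▸ hp.2.2)⟩
  have hcover : s ⊆ (I ∪ I.image f) ∪ J := by
    intro q hq
    by_contra hc
    simp only [Finset.mem_union, Finset.mem_image, hJ, Finset.mem_filter, not_or, not_exists,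
      not_and, hq, true_and] at hc
    obtain ⟨⟨h1, h2⟩, h3⟩ := hc
    have hq' : insert q I ∈ P := by
      refine (hmem _).mpr ⟨Finset.insert_subset hq hIs, fun a ha b hb hab => ?_⟩
      rcases Finset.mem_insert.mp ha with rfl | haI <;>
        rcases Finset.mem_insert.mp hb with rfl | hbI
      · exact absurd rfl hab
      · exact fun hf => h3 h1 (hf ▸ hbI)
      · exact h2 a haI
      · exact hind a haI b hbI hab
    have := hmax _ hq'
    rw [Finset.card_insert_of_notMem h1] at this
    omega
  have h1 := Finset.card_le_card hcover
  have h2 := Finset.card_union_le (I ∪ I.image f) J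
  have h3 := Finset.card_union_le I (I.image f)
  have h4 : (I.image f).card ≤ I.card := Finset.card_image_le
  have h5 := hmax J hJP
  omega

theorem exists_subset_injOn {α β : Type*} [DecidableEq β] (s : Finset α) (f : α → β) :
    ∃ t ⊆ s, t.card = (s.image f).card ∧ Set.InjOn f t := by
  classical
  induction s using Finset.induction_on with
  | empty => exact ⟨∅, by simp⟩
  | insert a s _ ih =>
    obtain ⟨t, h1, h2, h3⟩ := ih
    by_cases ha : f a ∈ s.image f
    · refine ⟨t, h1.trans (Finset.subset_insert _ _), ?_, h3⟩
      rw [Finset.image_insert, Finset.insert_eq_of_mem ha, h2]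
    · have hne : ∀ b ∈ t, f b ≠ f a := fun b hb hf =>
        ha (hf ▸ Finset.mem_image_of_mem f (h1 hb))
      have hat : a ∉ t := fun hat => hne a hat rfl
      refine ⟨insert a t, Finset.insert_subset_insert _ h1, ?_, ?_⟩
      · rw [Finset.image_insert, Finset.card_insert_of_notMem ha,
          Finset.card_insert_of_notMem hat, h2]
      · rw [Finset.coe_insert, Set.injOn_insert (by simpa using hat)]
        refine ⟨h3, ?_⟩
        rintro ⟨b, hb, hf⟩
        exact hne b (by simpa using hb) hf

namespace Algorithm

variable {A : Algorithm N Var Val Loc} {C C' : Config N Var Val Loc} {e : Event N Var Val}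
  {H L : List (Event N Var Val)} {p q w : Fin N} {o : Op} {T : Finset (Fin N)} {u : Var}

/-! ### Stable and poised processes -/

/-- If `p` runs alone from `C`, calling `poll` again and again, then it makes no remote memory
reference. -/
def Stable (A : Algorithm N Var Val Loc) (p : Fin N) (C : Config N Var Val Loc) : Prop :=
  ∀ L, (∀ e ∈ L, A.IsLocal p e) → A.Valid C L → ∀ e, e.proc = p → e.isSignalInvoke = false →
    A.Enabled (A.exec C L) e → A.isRMR e = false

/-- In configuration `C`, the next step of `p` is a write. -/
def Writing (A : Algorithm N Var Val Loc) (p : Fin N) (C : Config N Var Val Loc) : Prop :=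
  ∃ u x next, A.act p (C.loc p) = .write u x next

/-- In configuration `C`, the next step of `p` is a remote memory reference to `u`. -/
structure Poised (A : Algorithm N Var Val Loc) (p : Fin N) (u : Var) (C : Config N Var Val Loc) :
    Prop where
  owner : A.owner u ≠ p
  pending : C.pending p ≠ none
  act : (∃ next, A.act p (C.loc p) = .read u next) ∨ ∃ x next, A.act p (C.loc p) = .write u x next

theorem Poised.congr (h : A.Poised p u C) (h1 : C.loc p = C'.loc p)
    (h2 : C.pending p = C'.pending p) : A.Poised p u C' :=
  ⟨h.owner, h2 ▸ h.pending, h1 ▸ h.act⟩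

theorem Writing.congr (h : A.Writing p C) (h1 : C.loc p = C'.loc p) : A.Writing p C' := by
  unfold Writing at *
  rwa [h1] at h

theorem Poised.exists_event (h : A.Poised p u C) : ∃ e, e.proc = p ∧ e.target = some u ∧
    A.isRMR e = true ∧ A.Enabled C e ∧
      ((∃ p u x, e = .write p u x) ↔ A.Writing p C) := by
  obtain ⟨h1, h2, ⟨next, h3⟩ | ⟨x, next, h3⟩⟩ := h
  · exact ⟨.read p u (C.mem u), rfl, rfl, by simpa [isRMR] using h1, ⟨h2, ⟨next, h3⟩, rfl⟩,
      by simp [Writing, h3]⟩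
  · exact ⟨.write p u x, rfl, rfl, by simpa [isRMR] using h1, ⟨h2, ⟨next, h3⟩⟩,
      by simp [Writing, h3]⟩

theorem Stable.congr (h : A.Stable p C) (hv : A.SameView p C C') : A.Stable p C' := by
  intro L hL hV e hp hs he
  obtain ⟨h1, h2⟩ := hv.symm.exec hL hV
  by_contra hr
  -- The view of `p` determines its next action, though not the value that a remote read returns.
  cases e with
  | read q u x =>
    obtain rfl : q = p := hp
    have h3 : A.Enabled (A.exec C L) (.read q u ((A.exec C L).mem u)) :=
      ⟨h2.pending ▸ he.1, h2.loc ▸ he.2.1, rfl⟩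
    exact hr (h L hL h1 (.read q u _) rfl rfl h3 :)
  | write q u x =>
    obtain rfl : q = p := hp
    have h3 : A.Enabled (A.exec C L) (.write q u x) := ⟨h2.pending ▸ he.1, h2.loc ▸ he.2⟩
    exact hr (h L hL h1 _ rfl rfl h3)
  | _ => exact hr rfl

theorem Stable.exec (h : A.Stable p C) (hL : ∀ e ∈ L, A.IsLocal p e) (hv : A.Valid C L) :
    A.Stable p (A.exec C L) := by
  intro L' hL' hv' e hp hs he
  refine h (L ++ L') ?_ (valid_append.mpr ⟨hv, hv'⟩) e hp hs (by rwa [exec_append])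
  exact fun e he => (List.mem_append.mp he).elim (hL e) (hL' e)

theorem Stable.isLocal (h : A.Stable p C) (hL : ∀ e ∈ L, e.proc = p ∧ e.isSignalInvoke = false)
    (hv : A.Valid C L) : ∀ e ∈ L, A.IsLocal p e := by
  induction L generalizing C with
  | nil => simp
  | cons e L ih =>
    obtain ⟨hp, hs⟩ := hL e (by simp)
    have he : A.IsLocal p e := ⟨hp, h [] (by simp) trivial e hp hs hv.1, hs⟩
    have h' : A.Stable p (A.apply C e) :=
      h.exec (L := [e]) (by simpa using he) ⟨hv.1, trivial⟩
    intro e' he'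
    rcases List.mem_cons.mp he' with rfl | he'
    · exact he
    · exact ih h' (fun e he => hL e (by simp [he])) hv.2 e' he'

theorem exists_poised_of_not_stable (h : ¬ A.Stable p C) :
    ∃ L u, (∀ e ∈ L, A.IsLocal p e) ∧ A.Valid C L ∧ A.Poised p u (A.exec C L) := by
  unfold Stable at h
  push Not at h
  obtain ⟨L, hL, hv, e, hp, -, he, hr⟩ := h
  cases e with
  | read q u x =>
    obtain rfl : q = p := hp
    exact ⟨L, u, hL, hv, by simpa [isRMR] using hr, he.1, .inl he.2.1⟩
  | write q u x =>
    obtain rfl : q = p := hp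
    exact ⟨L, u, hL, hv, by simpa [isRMR] using hr, he.1, .inr ⟨x, he.2⟩⟩
  | invoke q o => simp [isRMR] at hr
  | ret q o b => simp [isRMR] at hr

theorem isSignalInvoke_of_target (h : e.target ≠ none) : e.isSignalInvoke = false := by
  cases e with
  | invoke p o => exact absurd rfl h
  | _ => rfl

theorem ne_invoke_of_target (h : e.target ≠ none) (p : Fin N) (o : Op) : e ≠ .invoke p o := by
  rintro rfl
  exact h rfl

theorem rmrBy_snoc (hp : e.proc = p) (hr : A.isRMR e = true) :
    A.rmrBy p (H ++ [e]) = A.rmrBy p H + 1 := by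
  rw [rmrBy_append]
  simp [rmrBy, hp, hr]

/-- A local state changes only with a step of the process. -/
theorem cfg_snoc_of_ne (h : e.proc ≠ q) : (A.cfg (H ++ [e]) T).loc q = (A.cfg H T).loc q ∧
    (A.cfg (H ++ [e]) T).pending q = (A.cfg H T).pending q := by
  by_cases hT : e.proc ∈ T
  · rw [cfg_snoc_of_mem hT]
    exact ⟨apply_loc_of_ne h, apply_pending_of_ne h⟩
  · rw [cfg_snoc_of_notMem hT]
    exact ⟨rfl, rfl⟩

namespace Stage

variable {act act' fin : Finset (Fin N)} {dep : Var → Fin N} {i : ℕ}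

/-! ### One more remote memory reference for every invisible process -/

theorem step (h : A.Stage i act fin dep H) (hp : e.proc ∈ act)
    (he : A.Enabled (A.cfg H (act ∪ fin)) e) (ht : e.target ≠ none)
    (hacc : ∀ v, e.target = some v → dep v = e.proc ∨ dep v ∉ act) :
    A.Stage i act fin (newDep dep e) (H ++ [e]) where
  family := h.family.step_clean subset_rfl (by simp [hp]) he hacc
    fun S hS => h.family.admissible_of_not_invoke (ne_invoke_of_target ht) hS
  noSignal e' he' := by
    rcases List.mem_append.mp he' with h' | h'
    · exact h.noSignal e' h'
    · rw [List.mem_singleton.mp h']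
      exact isSignalInvoke_of_target ht
  idle q hq := by
    rw [cfg_snoc_of_notMem (h.family.disj _ hp)]
    exact h.idle q hq
  card_fin := h.card_fin
  rmr q hq := by
    rw [rmrBy_append]
    exact (h.rmr q hq).trans (Nat.le_add_right _ _)

/-- If the invisible processes are about to make remote memory references that do not interfere
with each other, then all of them make one more without becoming visible. -/
theorem access (h : A.Stage i act fin dep H) (f : Fin N → Var)
    (hpo : ∀ p ∈ act, A.Poised p (f p) (A.cfg H (act ∪ fin)))
    (hind : ∀ p ∈ act, ∀ q ∈ act, p ≠ q → dep (f p) ≠ q)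
    (hwr : ∀ p ∈ act, ∀ q ∈ act, p ≠ q → A.Writing p (A.cfg H (act ∪ fin)) → f p ≠ f q) :
    ∃ dep' H', A.Stage (i + 1) act fin dep' H' := by
  suffices hT : ∀ T ⊆ act, ∃ dep' H', A.Stage i act fin dep' H' ∧
      (∀ p ∈ T, i + 1 ≤ A.rmrBy p H') ∧ ∀ p ∈ act, p ∉ T → dep' (f p) = dep (f p) ∧
        (A.cfg H (act ∪ fin)).loc p = (A.cfg H' (act ∪ fin)).loc p ∧
        (A.cfg H (act ∪ fin)).pending p = (A.cfg H' (act ∪ fin)).pending p by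
    obtain ⟨dep', H', h1, h2, -⟩ := hT act subset_rfl
    exact ⟨dep', H', h1.family, h1.noSignal, h1.idle, h1.card_fin.trans (Nat.le_succ i), h2⟩
  intro T
  induction T using Finset.induction_on with
  | empty => exact fun _ => ⟨dep, H, h, by simp, fun _ _ _ => ⟨rfl, rfl, rfl⟩⟩
  | insert p T hpT ih =>
    intro hsub
    obtain ⟨dep', H', h1, h2, h3⟩ := ih ((Finset.subset_insert _ _).trans hsub)
    have hp : p ∈ act := hsub (Finset.mem_insert_self _ _)
    obtain ⟨hd, hl, hpe⟩ := h3 p hp hpT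
    obtain ⟨e, rfl, htar, hr, hen, hwe⟩ := ((hpo p hp).congr hl hpe).exists_event
    refine ⟨newDep dep' e, H' ++ [e], h1.step hp hen (by simp [htar]) ?_, ?_, ?_⟩
    · intro v hv
      obtain rfl : f e.proc = v := Option.some.inj (htar.symm.trans hv)
      rw [hd]
      by_contra hc
      push Not at hc
      exact hind e.proc hp _ hc.2 (Ne.symm hc.1) rfl
    · intro q hq
      by_cases hqe : e.proc = q
      · rw [rmrBy_snoc hqe hr]
        exact Nat.succ_le_succ (h1.rmr q (hqe ▸ hp))
      · rw [rmrBy_append]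
        exact (h2 q ((Finset.mem_insert.mp hq).resolve_left (Ne.symm hqe))).trans
          (Nat.le_add_right _ _)
    · intro q hq hqT
      rw [Finset.mem_insert, not_or] at hqT
      obtain ⟨h4, h5, h6⟩ := h3 q hq hqT.2
      obtain ⟨h7, h8⟩ := cfg_snoc_of_ne (A := A) (H := H') (T := act ∪ fin) (Ne.symm hqT.1)
      refine ⟨?_, h5.trans h7.symm, h6.trans h8.symm⟩
      rw [newDep_of_ne, h4]
      intro p' x hew
      refine hwr e.proc hp q hq (Ne.symm hqT.1) ((hwe.mp ⟨p', f q, x, hew⟩).congr hl.symm) ?_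
      rw [hew] at htar
      rw [← Option.some.inj htar.symm, hew]

/-- If the invisible processes are about to write the same variable, then all of them make one more
remote memory reference. Only the last value survives: its writer `w` becomes visible and completes
its call. -/
theorem overwrite (hT : A.Terminating) {c : ℕ}
    (hbd : ∀ H ∈ A.histories, A.rmrCount H ≤ c * (participants H).card)
    (h : A.Stage i act fin dep H) (hw : w ∈ act)
    (hpo : ∀ p ∈ act, A.Poised p u (A.cfg H (act ∪ fin)))
    (hwr : ∀ p ∈ act, A.Writing p (A.cfg H (act ∪ fin))) :
    ∃ act' ⊆ act, act.card ≤ act'.card + 2 + c * (i + 1) ∧ ∃ fin' dep' H',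
      A.Stage (i + 1) act' fin' dep' H' := by
  set act₁ := (act.erase w).erase (A.owner u) with hact₁
  set fin₁ := insert w fin with hfin₁
  have hsub₁ : act₁ ⊆ act.erase w := Finset.erase_subset _ _
  have hsub : act₁ ⊆ act := hsub₁.trans (Finset.erase_subset _ _)
  have hw₁ : w ∉ act₁ := fun hc => by simp [hact₁] at hc
  have hou : A.owner u ∉ act₁ := by simp [hact₁]
  have hcard : act.card ≤ act₁.card + 2 := by
    have h1 := Finset.card_erase_add_one hw
    have h2 := Finset.pred_card_le_card_erase (s := act.erase w) (a := A.owner u)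
    rw [← hact₁] at h2
    omega
  have hf := (h.family.promote hw).erase hsub₁
  have hun : act₁ ∪ fin₁ = insert w act₁ ∪ fin := by
    rw [hfin₁, Finset.union_insert, Finset.insert_union]
  have hview : ∀ p ∈ act₁, A.SameView p (A.cfg H (act ∪ fin)) (A.cfg H (act₁ ∪ fin₁)) := by
    intro p hp
    rw [hun]
    exact h.family.view subset_rfl (Finset.insert_subset hw hsub) (hsub hp) (by simp [hp])
  have hvieww : A.SameView w (A.cfg H (act ∪ fin)) (A.cfg H fin₁) := by
    have := h.family.view subset_rfl (Finset.singleton_subset_iff.mpr hw) hw (by simp)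
    rwa [Finset.singleton_union] at this
  -- The writes of the others, while the value of `u` is considered indeterminate.
  have hall : ∀ T ⊆ act₁, ∃ H', A.Family {u} act₁ fin₁ dep H' ∧ NoSignal H' ∧
      (∀ q ∈ fin₁, (A.cfg H' fin₁).loc q = (A.cfg H fin₁).loc q ∧
        (A.cfg H' fin₁).pending q = (A.cfg H fin₁).pending q) ∧
      (∀ p ∈ act₁, i ≤ A.rmrBy p H') ∧ (∀ p ∈ T, i + 1 ≤ A.rmrBy p H') ∧
      ∀ p ∈ act₁, p ∉ T →
        (A.cfg H (act₁ ∪ fin₁)).loc p = (A.cfg H' (act₁ ∪ fin₁)).loc p ∧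
        (A.cfg H (act₁ ∪ fin₁)).pending p = (A.cfg H' (act₁ ∪ fin₁)).pending p := by
    intro T
    induction T using Finset.induction_on with
    | empty =>
      refine fun _ => ⟨H, ⟨hf.disj, hf.hist, hf.loc, hf.pending, fun S hS S' hS' v _ => ?_,
        fun v hv => ⟨?_, (hf.own v hv).2⟩⟩, h.noSignal, fun _ _ => ⟨rfl, rfl⟩,
        fun p hp => h.rmr p (hsub hp), by simp, fun _ _ _ => ⟨rfl, rfl⟩⟩
      · exact hf.mem S hS S' hS' v id
      · rintro rfl
        exact hou hv
    | insert p T hpT ih =>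
      intro hsubT
      obtain ⟨H', h1, h2, h3, h4, h5, h6⟩ := ih ((Finset.subset_insert _ _).trans hsubT)
      have hp : p ∈ act₁ := hsubT (Finset.mem_insert_self _ _)
      obtain ⟨hl, hpe⟩ := h6 p hp hpT
      have hv := hview p hp
      obtain ⟨e, rfl, htar, hr, hen, hwe⟩ :=
        ((hpo p (hsub hp)).congr (hv.loc.trans hl) (hv.pending.trans hpe)).exists_event
      obtain ⟨p', u', x, hew⟩ := hwe.mpr ((hwr _ (hsub hp)).congr (hv.loc.trans hl))
      obtain rfl : u' = u := by
        rw [hew] at htar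
        exact Option.some.inj htar
      have hpf : e.proc ∉ fin₁ := h1.disj _ hp
      refine ⟨H' ++ [e], h1.step subset_rfl (by simp [hp]) hen ?_ ?_ ?_ ?_, ?_, ?_, ?_, ?_, ?_⟩
      · intro p v x he
        rw [hew] at he
        simp at he
      · intro p v x he
        rw [hew] at he
        simp only [Event.write.injEq] at he
        obtain ⟨-, rfl, -⟩ := he
        exact ⟨fun hc => absurd hc hou, fun hc => absurd rfl hc⟩
      · exact fun v _ => ⟨Iff.rfl, rfl⟩
      · exact fun S hS _ => h1.admissible_of_not_invoke (ne_invoke_of_target (by simp [htar])) hS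
      · intro e' he'
        rcases List.mem_append.mp he' with h' | h'
        · exact h2 e' h'
        · rw [List.mem_singleton.mp h']
          exact isSignalInvoke_of_target (by simp [htar])
      · rw [cfg_snoc_of_notMem hpf]
        exact h3
      · intro q hq
        rw [rmrBy_append]
        exact (h4 q hq).trans (Nat.le_add_right _ _)
      · intro q hq
        by_cases hqe : e.proc = q
        · rw [rmrBy_snoc hqe hr]
          exact Nat.succ_le_succ (h4 q (hqe ▸ hp))
        · rw [rmrBy_append]
          exact (h5 q ((Finset.mem_insert.mp hq).resolve_left (Ne.symm hqe))).trans
            (Nat.le_add_right _ _)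
      · intro q hq hqT
        rw [Finset.mem_insert, not_or] at hqT
        obtain ⟨h7, h8⟩ := h6 q hq hqT.2
        obtain ⟨h9, h10⟩ := cfg_snoc_of_ne (A := A) (H := H') (T := act₁ ∪ fin₁) (Ne.symm hqT.1)
        exact ⟨h7.trans h9.symm, h8.trans h10.symm⟩
  obtain ⟨H', h1, h2, h3, -, h5, -⟩ := hall act₁ subset_rfl
  have hwf : w ∈ fin₁ := Finset.mem_insert_self _ _
  -- The write of `w` gives `u` a definite value again.
  obtain ⟨hl, hpe⟩ := h3 w hwf
  obtain ⟨e, he, htar, hr, hen, hwe⟩ := ((hpo w hw).congr (hvieww.loc.trans hl.symm)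
    (hvieww.pending.trans hpe.symm)).exists_event
  obtain ⟨p', u', x, hew⟩ := hwe.mpr ((hwr w hw).congr (hvieww.loc.trans hl.symm))
  obtain rfl : u' = u := by
    rw [hew] at htar
    exact Option.some.inj htar
  obtain rfl : p' = w := by
    rw [hew] at he
    exact he
  have hf₂ : A.Family ∅ act₁ fin₁ (newDep dep e) (H' ++ [e]) := by
    refine h1.step (Finset.empty_subset _) (by simp [he, hwf]) (by simpa using hen) ?_ ?_ ?_ ?_
    · intro p v x he
      rw [hew] at he
      simp at he
    · intro p v x he
      rw [hew] at he
      simp only [Event.write.injEq] at he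
      obtain ⟨rfl, rfl, -⟩ := he
      exact ⟨fun hc => absurd hc hou, fun _ => ⟨by simp [hew, newDep], .inl hwf⟩⟩
    · intro v hv
      refine ⟨?_, newDep_of_ne hv⟩
      have : v ≠ u' := by
        rintro rfl
        exact hv p' x hew
      simpa using this
    · exact fun S hS _ => h1.admissible_of_not_invoke (ne_invoke_of_target (by simp [htar])) hS
  have hpend : ∀ q, (A.cfg (H' ++ [e]) fin₁).pending q = (A.cfg H' fin₁).pending q := by
    intro q
    rw [cfg_snoc_of_mem (by rw [he]; exact hwf), apply_pending_of_target (by simp [htar])]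
  obtain ⟨o, ho⟩ := Option.ne_none_iff_exists'.mp (hpo p' hw).pending
  have hrun : (A.cfg (H' ++ [e]) fin₁).pending p' = some o := by
    rw [hpend, hpe, ← hvieww.pending, ho]
  have hothers : ∀ q ∈ fin₁, q ≠ p' → (A.cfg (H' ++ [e]) fin₁).pending q = none := by
    intro q hq hqw
    rw [hpend, (h3 q hq).2]
    have hqf : q ∈ fin := (Finset.mem_insert.mp hq).resolve_left hqw
    have h6 := h.family.pending _ (Finset.empty_subset _) _ (Finset.singleton_subset_iff.mpr hw)
      q (by simp [hqf]) (by simp [hqf])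
    rw [Finset.singleton_union, Finset.empty_union, h.idle q hqf] at h6
    exact h6.symm
  have hown : ∀ v, A.owner v = p' → newDep dep e v ∉ act₁ := by
    intro v hv
    rcases newDep_eq_or (dep := dep) (e := e) (v := v) with h6 | h6
    · rw [h6, (h.family.own v (hv ▸ hw)).2, hv]
      exact hw₁
    · rw [h6, he]
      exact hw₁
  obtain ⟨L, b, hL, hidle, act', hsub', hcard', dep', hfam, -⟩ :=
    hf₂.rollForward hT hbd hwf hrun hothers hown
  refine ⟨act', hsub'.trans hsub, ?_, fin₁, dep', _, hfam, ?_, hidle, ?_, ?_⟩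
  · have h6 := Finset.card_insert_le p' fin
    have h7 : c * fin₁.card ≤ c * (i + 1) :=
      Nat.mul_le_mul_left _ (h6.trans (Nat.succ_le_succ h.card_fin))
    omega
  · intro e' he'
    simp only [List.mem_append, List.mem_singleton] at he'
    rcases he' with (h' | rfl) | h' | rfl
    · exact h2 e' h'
    · exact isSignalInvoke_of_target (by simp [htar])
    · exact isSignalInvoke_of_target (hL e' h').2
    · rfl
  · exact (Finset.card_insert_le _ _).trans (Nat.succ_le_succ h.card_fin)
  · intro q hq
    rw [rmrBy_append, rmrBy_append]
    have := h5 q (hsub' hq)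
    omega

end Stage
end Algorithm

/-! ### Counting remote memory references -/

namespace Algorithm

variable {A : Algorithm N Var Val Loc} {H : List (Event N Var Val)} {p q : Fin N}

theorem sum_rmrBy_le {s T : Finset (Fin N)} (hs : s ⊆ T) :
    ∑ p ∈ s, A.rmrBy p H ≤ A.rmrCount (proj T H) := by
  induction H using List.reverseRecOn with
  | nil => simp [rmrBy]
  | append_singleton H e ih =>
    simp only [rmrBy_append, Finset.sum_add_distrib]
    rw [proj_append, rmrCount, List.countP_append]
    refine Nat.add_le_add ih ?_
    cases hr : A.isRMR e with
    | false => simp [rmrBy, hr]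
    | true =>
      by_cases he : e.proc ∈ s
      · have : proj T [e] = [e] := proj_eq_self (by simpa using hs he)
        rw [this]
        simp [rmrBy, hr, he, List.countP_cons]
      · simp [rmrBy, hr, he, List.countP_cons]

/-- The number of invisible processes that suffices for a round after which at least `M` of them
are left. -/
def roundSize (c M : ℕ) : ℕ := M + (3 * M + (M + 2 + c * (c + 2)) * (3 * M))

/-- The number of invisible processes that suffices for `j` rounds and the final signal. -/
def startSize (c : ℕ) : ℕ → ℕ
  | 0 => c * (c + 2) + 2
  | j + 1 => roundSize c (startSize c j)

theorem le_startSize (c j : ℕ) : c * (c + 2) + 2 ≤ startSize c j := by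
  induction j with
  | zero => exact le_rfl
  | succ j ih =>
    rw [startSize, roundSize]
    omega

namespace Stage

variable {act fin : Finset (Fin N)} {dep : Var → Fin N} {i c : ℕ}

theorem idle_of_subset (h : A.Stage i act fin dep H) {S : Finset (Fin N)} (hS : S ⊆ act)
    (hq : q ∈ fin) : (A.cfg H (S ∪ fin)).pending q = none := by
  have := h.family.pending S hS ∅ (Finset.empty_subset _) q (by simp [hq]) (by simp [hq])
  rw [this, Finset.empty_union]
  exact h.idle q hq

/-- Stable processes can be brought into a state between two calls. -/
theorem settle (hA : A.SolvesSignaling) (hT : A.Terminating) (h : A.Stage i act fin dep H)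
    (hst : ∀ p ∈ act, A.Stable p (A.cfg H (act ∪ fin))) :
    ∃ H', A.Stage i act fin dep H' ∧ ∀ p ∈ act, A.Stable p (A.cfg H' (act ∪ fin)) ∧
      (A.cfg H' (act ∪ fin)).pending p = none := by
  have hex : ∀ p, ∃ L, p ∈ act → (∀ e ∈ L, A.IsLocal p e) ∧ A.Valid (A.cfg H (act ∪ fin)) L ∧
      (A.exec (A.cfg H (act ∪ fin)) L).pending p = none := by
    intro p
    by_cases hp : p ∈ act
    · have hsub : {p} ⊆ act := Finset.singleton_subset_iff.mpr hp
      have hv := h.family.view hsub subset_rfl (Finset.mem_singleton_self p) hp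
      rcases ho : (A.cfg H ({p} ∪ fin)).pending p with _ | o
      · exact ⟨[], fun _ => ⟨by simp, trivial, hv.pending.symm.trans ho⟩⟩
      · obtain ⟨L, b, hL, hV⟩ := hT.solo_completes (h.family.hist _ hsub) ho fun q hq => by
          by_cases hqf : q ∈ fin
          · exact h.idle_of_subset hsub hqf
          · exact cfg_pending_of_notMem (by simp [hq, hqf])
        have hloc := ((hst p hp).congr hv.symm).isLocal (L := L ++ [Event.ret p o b]) (by
          intro e he
          rcases List.mem_append.mp he with he | he
          · exact ⟨(hL e he).1, isSignalInvoke_of_target (hL e he).2⟩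
          · rw [List.mem_singleton.mp he]
            exact ⟨rfl, rfl⟩) hV
        obtain ⟨hV', hv'⟩ := hv.exec hloc hV
        refine ⟨_, fun _ => ⟨hloc, hV', ?_⟩⟩
        rw [← hv'.pending, exec_append]
        simp [Algorithm.apply]
    · exact ⟨[], fun hc => absurd hc hp⟩
  choose L hL using hex
  obtain ⟨H', h1, h2⟩ := h.advance hA L (fun p hp => (hL p hp).1) (fun p hp => (hL p hp).2.1)
  refine ⟨H', h1, fun p hp => ⟨?_, (h2 p hp).pending.trans (hL p hp).2.2⟩⟩
  exact ((hst p hp).exec (hL p hp).1 (hL p hp).2.1).congr (h2 p hp).symm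

/-! ### Rounds -/

/-- One round: either many invisible processes are stable, or many of them can make another
remote memory reference while at most one process becomes visible. -/
theorem round (hA : A.SolvesSignaling) (hT : A.Terminating)
    (hbd : ∀ H ∈ A.histories, A.rmrCount H ≤ c * (participants H).card)
    (h : A.Stage i act fin dep H) (hi : i ≤ c + 1) {M : ℕ} (hM₀ : 0 < M)
    (hM : roundSize c M ≤ act.card) :
    (∃ act' H', M ≤ act'.card ∧ A.Stage i act' fin dep H' ∧
      ∀ p ∈ act', A.Stable p (A.cfg H' (act' ∪ fin)) ∧
        (A.cfg H' (act' ∪ fin)).pending p = none) ∨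
    ∃ act' fin' dep' H', M ≤ act'.card ∧ A.Stage (i + 1) act' fin' dep' H' := by
  classical
  have hsplit := Finset.card_filter_add_card_filter_not (s := act)
    fun p => A.Stable p (A.cfg H (act ∪ fin))
  set st := act.filter fun p => A.Stable p (A.cfg H (act ∪ fin)) with hst
  set un := act.filter fun p => ¬ A.Stable p (A.cfg H (act ∪ fin)) with hun
  by_cases hcard : M ≤ st.card
  · left
    have hsub : st ⊆ act := Finset.filter_subset _ _
    obtain ⟨H', h1, h2⟩ := (h.erase hsub).settle hA hT fun p hp =>
      (Finset.mem_filter.mp hp).2.congr (h.family.view subset_rfl hsub (hsub hp) hp)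
    exact ⟨st, H', hcard, h1, h2⟩
  right
  have hsub : un ⊆ act := Finset.filter_subset _ _
  have hun_card : 3 * M + (M + 2 + c * (c + 2)) * (3 * M) ≤ un.card := by
    rw [roundSize] at hM
    omega
  -- Let every remaining process run until it is about to make a remote memory reference.
  have hex : ∀ p ∈ un, ∃ L u, (∀ e ∈ L, A.IsLocal p e) ∧
      A.Valid (A.cfg H (un ∪ fin)) L ∧ A.Poised p u (A.exec (A.cfg H (un ∪ fin)) L) :=
    fun p hp => exists_poised_of_not_stable fun hc =>
      (Finset.mem_filter.mp hp).2 (hc.congr (h.family.view hsub subset_rfl hp (hsub hp)))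
  have : Nonempty Var := by
    obtain ⟨p, hp⟩ : un.Nonempty := Finset.card_pos.mp (by omega)
    obtain ⟨-, u, -⟩ := hex p hp
    exact ⟨u⟩
  choose! L f hLf using hex
  obtain ⟨H₁, h1, h2⟩ := (h.erase hsub).advance hA L (fun p hp => (hLf p hp).1)
    (fun p hp => (hLf p hp).2.1)
  have hpo : ∀ p ∈ un, A.Poised p (f p) (A.cfg H₁ (un ∪ fin)) := fun p hp =>
    (hLf p hp).2.2.congr (h2 p hp).loc.symm (h2 p hp).pending.symm
  -- Poised and writing processes remain so when others are erased.
  have hpo' : ∀ S ⊆ un, ∀ p ∈ S, A.Poised p (f p) (A.cfg H₁ (S ∪ fin)) := fun S hS p hp =>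
    have hv := h1.family.view subset_rfl hS (hS hp) hp
    (hpo p (hS hp)).congr hv.loc hv.pending
  have hwr : ∀ S ⊆ un, ∀ p ∈ S, (A.Writing p (A.cfg H₁ (S ∪ fin)) ↔
      A.Writing p (A.cfg H₁ (un ∪ fin))) := fun S hS p hp =>
    have hv := h1.family.view subset_rfl hS (hS hp) hp
    ⟨fun hc => hc.congr hv.loc.symm, fun hc => hc.congr hv.loc⟩
  have hsplit' := Finset.card_filter_add_card_filter_not (s := un)
    fun p => A.Writing p (A.cfg H₁ (un ∪ fin))
  set W := un.filter fun p => A.Writing p (A.cfg H₁ (un ∪ fin)) with hW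
  set R := un.filter fun p => ¬ A.Writing p (A.cfg H₁ (un ∪ fin)) with hR
  have hWsub : W ⊆ un := Finset.filter_subset _ _
  have hRsub : R ⊆ un := Finset.filter_subset _ _
  by_cases hRcard : 3 * M ≤ R.card
  · obtain ⟨t, ht, htc, hind⟩ := exists_independent R fun p => dep (f p)
    have hts : t ⊆ un := ht.trans hRsub
    obtain ⟨dep', H', h3⟩ := (h1.erase hts).access f (hpo' t hts) hind fun p hp q _ _ hc =>
      absurd ((hwr t hts p hp).mp hc) (Finset.mem_filter.mp (ht hp)).2
    exact ⟨t, fin, dep', H', by omega, h3⟩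
  have hWcard : (M + 2 + c * (c + 2)) * (3 * M) < W.card := by omega
  by_cases himg : 3 * M ≤ (W.image f).card
  · obtain ⟨V, hV, hVc, hinj⟩ := exists_subset_injOn W f
    obtain ⟨t, ht, htc, hind⟩ := exists_independent V fun p => dep (f p)
    have hts : t ⊆ un := (ht.trans hV).trans hWsub
    obtain ⟨dep', H', h3⟩ := (h1.erase hts).access f (hpo' t hts) hind fun p hp q hq hpq _ hc =>
      hpq (hinj (ht hp) (ht hq) hc)
    exact ⟨t, fin, dep', H', by omega, h3⟩
  · obtain ⟨u, -, hu⟩ : ∃ u ∈ W.image f,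
        M + 2 + c * (c + 2) < (W.filter fun p => f p = u).card := by
      by_contra! hc
      have := Finset.card_le_mul_card_image (s := W) (f := f) (M + 2 + c * (c + 2)) hc
      have h3 := Nat.mul_le_mul_left (M + 2 + c * (c + 2)) (not_le.mp himg).le
      omega
    set B := W.filter fun p => f p = u with hB
    have hBW : B ⊆ W := Finset.filter_subset _ _
    have hBs : B ⊆ un := hBW.trans hWsub
    obtain ⟨w, hw⟩ : B.Nonempty := Finset.card_pos.mp (by omega)
    obtain ⟨act', -, hc, fin', dep', H', h3⟩ := (h1.erase hBs).overwrite hT hbd hw (u := u)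
      (fun p hp => (Finset.mem_filter.mp hp).2 ▸ hpo' B hBs p hp)
      (fun p hp => (hwr B hBs p hp).mpr (Finset.mem_filter.mp (hBW hp)).2)
    refine ⟨act', fin', dep', H', ?_, h3⟩
    have : c * (i + 1) ≤ c * (c + 2) := Nat.mul_le_mul_left _ (by omega)
    omega

/-! ### The signal -/

/-- Many stable processes between calls are impossible. One of them, `s`, calls `signal`; whenever
it is about to notice or to notify another invisible process, that one is erased. So `signal`
completes, and some remaining process `p` still sees what it saw before. Its next call to `poll`
must return `true` because the signal is complete, and `false` because the same call is possible
without the signal. -/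
theorem false_of_stable (hA : A.SolvesSignaling) (hT : A.Terminating)
    (hbd : ∀ H ∈ A.histories, A.rmrCount H ≤ c * (participants H).card)
    (h : A.Stage i act fin dep H) (hst : ∀ p ∈ act, A.Stable p (A.cfg H (act ∪ fin)) ∧
      (A.cfg H (act ∪ fin)).pending p = none)
    (hcard : c * (fin.card + 1) + 2 ≤ act.card) : False := by
  obtain ⟨s, hs⟩ : act.Nonempty := Finset.card_pos.mp (by omega)
  set act₁ := act.erase s with hact₁
  set fin₁ := insert s fin with hfin₁
  have hs₁ : s ∉ act₁ := Finset.notMem_erase _ _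
  have hsf : s ∈ fin₁ := Finset.mem_insert_self _ _
  have hun : act₁ ∪ fin₁ = act ∪ fin := by
    rw [hfin₁, Finset.union_insert, ← Finset.insert_union, hact₁, Finset.insert_erase hs]
  have hf := h.family.promote hs
  have hidle₁ : ∀ q ∈ fin₁, (A.cfg H fin₁).pending q = none := by
    intro q hq
    have h1 : {s} ∪ fin = fin₁ := Finset.singleton_union _ _
    have hsub := Finset.singleton_subset_iff.mpr hs
    rw [← h1]
    rcases Finset.mem_insert.mp hq with rfl | hqf
    · rw [(h.family.view hsub subset_rfl (Finset.mem_singleton_self q) hs).pending]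
      exact (hst q hs).2
    · exact h.idle_of_subset hsub hqf
  set e : Event N Var Val := .invoke s .signal with he
  have hf₁ : A.Family ∅ act₁ fin₁ dep (H ++ [e]) :=
    hf.step_clean (e := e) (Finset.empty_subset _) (Finset.mem_union_right _ hsf)
      (by rw [Finset.empty_union]; exact hidle₁ s hsf) (by simp [he, Event.target])
      fun S hS => hf.admissible_of_noSignal hA h.noSignal hS
  have hc₁ : A.cfg (H ++ [e]) fin₁ = A.apply (A.cfg H fin₁) e := cfg_snoc_of_mem hsf
  obtain ⟨L, b, hL, hidle, act', hsub', hcard', dep', hfam, hview⟩ :=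
    hf₁.rollForward (o := .signal) hT hbd hsf
      (by rw [hc₁]; simp [Algorithm.apply, he])
      (by
        intro q hq hqs
        rw [hc₁, apply_pending_of_ne (Ne.symm hqs)]
        exact hidle₁ q hq)
      (by
        intro v hv
        rw [(h.family.own v (hv ▸ hs)).2, hv]
        exact hs₁)
  obtain ⟨p, hp⟩ : act'.Nonempty := by
    refine Finset.card_pos.mp ?_
    have h1 := Finset.card_erase_add_one hs
    have h2 : c * fin₁.card ≤ c * (fin.card + 1) :=
      Nat.mul_le_mul_left _ (Finset.card_insert_le _ _)
    rw [← hact₁] at h1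
    omega
  set H₂ := H ++ [e] ++ (L ++ [.ret s .signal b]) with hH₂
  have hp₁ : p ∈ act₁ := hsub' hp
  have hpa : p ∈ act := Finset.mem_of_mem_erase hp₁
  have hps : s ≠ p := fun hc => hs₁ (hc ▸ hp₁)
  have hpsub : {p} ⊆ act' := Finset.singleton_subset_iff.mpr hp
  have hpsub₁ : {p} ⊆ act := Finset.singleton_subset_iff.mpr hpa
  have hpp := Finset.mem_singleton_self p
  -- Process `p` has not noticed the signal.
  have hv : A.SameView p (A.cfg H₂ ({p} ∪ fin₁)) (A.cfg H (act ∪ fin)) := by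
    refine (hfam.view hpsub subset_rfl hpp hp).trans ((hview p hp).trans ?_)
    rw [hun, cfg_snoc_of_mem (by simp [he, Event.proc, hs])]
    exact sameView_apply_of_ne hps (by simp [he, Event.target])
  have hstab : A.Stable p (A.cfg H₂ ({p} ∪ fin₁)) := (hst p hpa).1.congr hv.symm
  have hpend : (A.cfg H₂ ({p} ∪ fin₁)).pending p = none := hv.pending.trans (hst p hpa).2
  set K := proj ({p} ∪ fin₁) H₂ with hK
  have hKh : K ∈ A.histories := hfam.hist _ hpsub
  have hpf : {p} ⊆ act₁ := Finset.singleton_subset_iff.mpr hp₁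
  have hret : .ret p .poll true ∉ K := by
    intro hmem
    have h1 : .ret p .poll true ∈ H := by
      have h2 := mem_of_mem_proj hmem
      simp only [hH₂, List.mem_append, List.mem_singleton] at h2
      rcases h2 with (h2 | h2) | h2 | h2
      · exact h2
      · simp [he] at h2
      · exact absurd (hL _ h2).2 (by simp [Event.target])
      · simp at h2
    refine hA.ret_true_notMem (p := p) (hf.hist _ hpf)
      (fun e he => h.noSignal e (mem_of_mem_proj he)) (List.mem_filter.mpr ⟨h1, ?_⟩)
    simp [Event.proc]
  set e' : Event N Var Val := .invoke p .poll with he'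
  have hKh' : K ++ [e'] ∈ A.histories := by
    refine mem_histories.mpr ⟨valid_append.mpr ⟨(mem_histories.mp hKh).1, hpend, trivial⟩, ?_⟩
    refine (mem_histories.mp hKh).2.snoc (by simp [he', Event.isSignalInvoke]) ?_
    intro q hq
    obtain rfl : p = q := by simpa [he'] using hq
    exact hret
  have hafter : A.after (K ++ [e']) = A.apply (A.cfg H₂ ({p} ∪ fin₁)) e' := after_append
  obtain ⟨L', b', hL', hV'⟩ := hT.solo_completes (o := .poll) (p := p) hKh'
    (by rw [hafter]; simp [Algorithm.apply, he'])
    (by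
      intro q hq
      rw [hafter, apply_pending_of_ne (Ne.symm hq)]
      by_cases hqf : q ∈ fin₁
      · rw [hfam.pending _ hpsub ∅ (Finset.empty_subset _) q (by simp [hqf]) (by simp [hqf]),
          Finset.empty_union]
        exact hidle q hqf
      · exact cfg_pending_of_notMem (by simp [hq, hqf]))
  have hninv : ∀ e ∈ L' ++ [.ret p .poll b'], ∀ p o, e ≠ .invoke p o := by
    intro e he
    rcases List.mem_append.mp he with he | he
    · exact ne_invoke_of_target (hL' e he).2
    · rw [List.mem_singleton.mp he]
      simp
  have hKh'' := histories_append_of_not_invoke hKh' hninv hV'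
  cases b' with
  | false =>
    rw [← List.append_assoc] at hKh''
    obtain ⟨i, hi⟩ := exists_isCall (mem_histories.mp hKh'').1
    have hiK : K.length ≤ i := by
      by_contra! hlt
      have h1 := hi.2.1
      rw [List.append_assoc, List.append_assoc,
        List.getElem?_append_left hlt] at h1
      rcases ret_or_pending (mem_histories.mp hKh).1 h1 with ⟨j, hij, b, hb⟩ | hc
      · have hjl := (List.getElem?_eq_some_iff.mp hb).1
        refine hi.2.2.2 j hij (by simp; omega) .poll b ?_
        rwa [List.append_assoc, List.append_assoc,
          List.getElem?_append_left hjl]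
      · exact absurd (hpend.symm.trans hc) (by simp)
    have hsK : .ret s .signal b ∈ K := by
      refine List.mem_filter.mpr ⟨by simp [hH₂], ?_⟩
      simp [Event.proc, hsf]
    obtain ⟨m, hm⟩ := List.getElem?_of_mem hsK
    have hml := (List.getElem?_eq_some_iff.mp hm).1
    refine (hA _ hKh'').2 p i _ hi m (by omega) s b ?_
    rwa [List.append_assoc, List.append_assoc, List.getElem?_append_left hml]
  | true =>
    -- The same call to `poll`, without the signal.
    have hV₂ : A.Valid (A.cfg H₂ ({p} ∪ fin₁)) (e' :: (L' ++ [.ret p .poll true])) :=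
      ⟨hpend, by rwa [hafter] at hV'⟩
    have hloc := hstab.isLocal (L := e' :: (L' ++ [.ret p .poll true])) (by
      intro e he
      simp only [List.mem_cons, List.mem_append, List.not_mem_nil, or_false] at he
      rcases he with rfl | he | rfl
      · exact ⟨rfl, rfl⟩
      · exact ⟨(hL' e he).1, isSignalInvoke_of_target (hL' e he).2⟩
      · exact ⟨rfl, rfl⟩) hV₂
    have hv₀ := hv.trans (h.family.view subset_rfl hpsub₁ hpa hpp)
    obtain ⟨hen, hV₀⟩ := (hv₀.exec hloc hV₂).1
    have hns : NoSignal (proj ({p} ∪ fin) H) := fun e he => h.noSignal e (mem_of_mem_proj he)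
    have hh := h.family.hist _ hpsub₁
    have hh' : proj ({p} ∪ fin) H ++ [e'] ∈ A.histories := mem_histories.mpr
      ⟨valid_append.mpr ⟨(mem_histories.mp hh).1, hen, trivial⟩,
        h.family.admissible_of_noSignal hA h.noSignal hpsub₁⟩
    have hh'' := histories_append_of_not_invoke hh' hninv (by rw [after_append]; exact hV₀)
    refine hA.ret_true_notMem (p := p) hh'' (fun e he => ?_) (by simp)
    rcases List.mem_append.mp he with he | he
    · rcases List.mem_append.mp he with he | he
      · exact hns e he
      · rw [List.mem_singleton.mp he]
        rfl
    · exact (hloc e (List.mem_cons_of_mem _ he)).signal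

/-- A large enough stage with `j` rounds to go contradicts the bound on the number of remote memory
references. -/
theorem false_of_large (hA : A.SolvesSignaling) (hT : A.Terminating)
    (hbd : ∀ H ∈ A.histories, A.rmrCount H ≤ c * (participants H).card) (j : ℕ)
    (h : A.Stage i act fin dep H) (hij : i + j = c + 1) (hcard : startSize c j ≤ act.card) :
    False := by
  induction j generalizing i act fin dep H with
  | zero =>
    obtain rfl : i = c + 1 := hij
    have h1 := hbd _ (h.family.hist act subset_rfl)
    have h2 : (participants (proj (act ∪ fin) H)).card ≤ act.card + (c + 1) := by
      refine (Finset.card_le_card (t := act ∪ fin) fun q hq => ?_).trans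
        ((Finset.card_union_le _ _).trans (Nat.add_le_add_left h.card_fin _))
      simp only [participants, List.mem_toFinset, List.mem_map] at hq
      obtain ⟨e, he, rfl⟩ := hq
      exact proc_mem_of_mem_proj he
    have h3 := sum_rmrBy_le (A := A) (H := H) (Finset.subset_union_left (s₁ := act) (s₂ := fin))
    have h4 := Finset.card_nsmul_le_sum act (fun p => A.rmrBy p H) (c + 1) h.rmr
    have h5 := Nat.mul_le_mul_left c h2
    simp only [startSize, smul_eq_mul] at hcard h4
    nlinarith
  | succ j ih =>
    rcases h.round hA hT hbd (by omega) (M := startSize c j)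
      (by have := le_startSize c j; omega) hcard with
      ⟨act', H', h1, h2, h3⟩ | ⟨act', fin', dep', H', h1, h2⟩
    · refine h2.false_of_stable hA hT hbd h3 (le_trans ?_ ((le_startSize c j).trans h1))
      have h4 : fin.card + 1 ≤ c + 2 := by
        have := h.card_fin
        omega
      have := Nat.mul_le_mul_left c h4
      omega
    · exact ih h2 (by omega) h1

end Stage
end Algorithm

end Signaling

theorem theorem1 (c : ℕ) (hc : 0 < c) :
    ∃ N₀ : ℕ, ∀ N : ℕ, N₀ ≤ N →
      ∀ (Var : Type u) (Val : Type v) (Loc : Type w) (A : Signaling.Algorithm N Var Val Loc),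
        A.SolvesSignaling → A.Terminating →
          ∃ k : ℕ, 0 < k ∧ ∃ H ∈ A.histories,
            (Signaling.participants H).card = k ∧ c * k < A.rmrCount H := by
  refine ⟨Signaling.Algorithm.startSize c (c + 1), fun N hN Var Val Loc A hA hT => ?_⟩
  by_contra! hbd
  have hbd' : ∀ H ∈ A.histories, A.rmrCount H ≤ c * (Signaling.participants H).card := by
    intro H hH
    rcases Nat.eq_zero_or_pos (Signaling.participants H).card with h0 | h0
    · have : H = [] := by
        simpa [Signaling.participants] using h0
      simp [this, Signaling.Algorithm.rmrCount]
    · exact hbd _ h0 H hH rfl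
  have hinit : A.Stage 0 Finset.univ ∅ A.owner [] :=
    ⟨.init, by simp [Signaling.NoSignal], by simp, by simp, by simp⟩
  exact hinit.false_of_large hA hT hbd' (c + 1) (by omega) (by simpa using hN)
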